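/- Let $V$ be an $n$-dimensional complex vector space with a nondegenerate symmetric bilinear form, let $O(V)$ be its orthogonal group, and let $e_1,\dots,e_n$ be an orthonormal basis of $V$. Let $\Lambda_2(V)$ be the second exterior power of $V$, and let $O(V)$ act naturally on the exterior algebra $\Lambda(\Lambda_2(V))$ by algebra automorphisms. Put $a_{ij}=e_i\wedge e_j\in\Lambda_2(V)$, let $A=(a_{ij})_{1\le i,j\le n}\in\operatorname{Mat}_{n,n}(\Lambda(\Lambda_2(V)))$, and put $q_k=\operatorname{tr}(A^k)$. Then the algebra of invariants $\Lambda(\Lambda_2(V))^{O(V)}$ is generated by the following elements, and these anticommute with each other and have no other relations: \[ q_3,\,q_7,\,q_{11},\,\dots,\,q_{4m-5}\quad\text{if } n=2m,\qquad q_3,\,q_7,\,q_{11},\,\dots,\,q_{4m-1}\quad\text{if } n=2m+1. \] That is, $\Lambda(\Lambda_2(V))^{O(V)}$ is freely generated, as an exterior algebra, by these elements. (For $n\le 2$ the list is empty and the algebra of invariants is $\mathbb{C}$.) -/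

import Mathlib

noncomputable section

/-- The orthogonal group `O(V)` of a complex vector space `V` with a bilinear form `B`:
the linear automorphisms of `V` that preserve `B`. -/
def orthogonalGroupOf {V : Type*} [AddCommGroup V] [Module ℂ V]
    (B : LinearMap.BilinForm ℂ V) : Subgroup (V ≃ₗ[ℂ] V) where
  carrier := {g | ∀ v w : V, B (g v) (g w) = B v w}
  mul_mem' := by
    intro g h hg hh v w
    rw [LinearEquiv.mul_apply, LinearEquiv.mul_apply, hg, hh]
  one_mem' := by
    intro v w
    rfl
  inv_mem' := by
    intro g hg v w
    rw [← hg (g⁻¹ v) (g⁻¹ w), ← LinearEquiv.mul_apply, ← LinearEquiv.mul_apply, mul_inv_cancel]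
    rfl

/-- The exterior algebra `Λ(Λ₂(V))` on the second exterior power `Λ₂(V)` of `V`. -/
abbrev ExtAlgLambdaTwo (V : Type*) [AddCommGroup V] [Module ℂ V] : Type _ :=
  ExteriorAlgebra ℂ (⋀[ℂ]^2 V)

/-- The natural action `π(g)` of a linear map `g` on `Λ(Λ₂(V))`: the algebra endomorphism induced
by `v ∧ w ↦ g v ∧ g w` on `Λ₂(V)`. -/
def lambdaTwoAction {V : Type*} [AddCommGroup V] [Module ℂ V] (g : V →ₗ[ℂ] V) :
    ExtAlgLambdaTwo V →ₐ[ℂ] ExtAlgLambdaTwo V :=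
  ExteriorAlgebra.map (exteriorPower.map 2 g)

/-- The algebra of invariants `Λ(Λ₂(V))^{O(V)}`. -/
def orthogonalInvariants {V : Type*} [AddCommGroup V] [Module ℂ V]
    (B : LinearMap.BilinForm ℂ V) : Subalgebra ℂ (ExtAlgLambdaTwo V) where
  carrier := {x | ∀ g ∈ orthogonalGroupOf B, lambdaTwoAction (g : V →ₗ[ℂ] V) x = x}
  mul_mem' := by
    intro x y hx hy g hg
    rw [map_mul, hx g hg, hy g hg]
  add_mem' := by
    intro x y hx hy g hg
    rw [map_add, hx g hg, hy g hg]
  algebraMap_mem' := by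
    intro r g _
    exact AlgHom.commutes _ r

/-- The matrix `A = (a_{ij})` over `Λ(Λ₂(V))` with entries `a_{ij} = e_i ∧ e_j ∈ Λ₂(V)`. -/
def matrixA {V : Type*} [AddCommGroup V] [Module ℂ V] {n : ℕ} (e : Fin n → V) :
    Matrix (Fin n) (Fin n) (ExtAlgLambdaTwo V) :=
  Matrix.of fun i j => ExteriorAlgebra.ι ℂ (exteriorPower.ιMulti ℂ 2 ![e i, e j])

/-- `q_k = tr(A^k)`. -/
def qTrace {V : Type*} [AddCommGroup V] [Module ℂ V] {n : ℕ} (e : Fin n → V) (k : ℕ) :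
    ExtAlgLambdaTwo V :=
  (matrixA e ^ k).trace

/-- The subalgebra `S` of `R` is freely generated, as an exterior algebra, by `x_0, …, x_{r-1}`:
these elements generate `S`, they anticommute with each other, and they have no other relations,
that is, the homomorphism from the exterior algebra on `r` generators to `R` which sends the
`i`-th generator to `x_i` exists and is injective. -/
structure FreelyGeneratedAsExteriorAlgebra {R : Type*} [Ring R] [Algebra ℂ R]
    (S : Subalgebra ℂ R) {r : ℕ} (x : Fin r → R) : Prop where
  generates : Algebra.adjoin ℂ (Set.range x) = S
  anticommute : ∀ i j, x i * x j = -(x j * x i)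
  no_other_relations : ∃ φ : ExteriorAlgebra ℂ (Fin r → ℂ) →ₐ[ℂ] R,
    (∀ i, φ (ExteriorAlgebra.ι ℂ (Pi.single i 1)) = x i) ∧ Function.Injective φ

end

/-!
**Generation.** Let `W` be the average of the action of `G` on `Λ(Λ₂(V))` over real Gaussian
matrices `G`. The image of `a_{ij}` under `G` is an entry of `Gᵀ A G`, and Stein's integration by
parts reduces the expectation of a product of entries of words `Gᵀ A^k G` to expectations of shorter
products, times traces `tr (A^k)`. So `W` takes values in the algebra generated by these traces,
which consists of invariants. The basis of `V` defines a positive Hermitian form on `Λ(Λ₂(V))` for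
which `G` and `Gᴴ` act adjointly; by polar decomposition the action of a real matrix on the
invariants is that of a positive semidefinite one, so `W` is positive definite on the invariants.
Being an injective endomorphism of a finite-dimensional space with values in the trace algebra, it
shows that every invariant lies there.

**Vanishing.** Transposition and cyclicity of the trace give `q_k = 0` unless `k ≡ 3 mod 4`. Over
the commutative even part `A²` is skew-symmetric and, for two further odd variables `x` and `y`,
conjugation by `1 + xA` multiplies `A² + yA` by `1 - 2xy`. Comparing characteristic polynomials and
Pfaffians yields `A^{2n} = 0` and `q_{2n-1} = 0`.

**Freeness.** For odd `n` the top form of `Λ(Λ₂(V))` is invariant, since `det Λ²g = det g ^ (n-1)`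
by Sylvester–Franke. So it is a polynomial in the traces, and by degree it is a nonzero multiple of
their product `q_3 q_7 ⋯`; hence this product is nonzero, which is what freeness means. Even `n`
reduces to `n - 1` by sending the last basis vector to zero.
-/

noncomputable section

section Gaussian

open MeasureTheory ProbabilityTheory
open scoped NNReal

theorem integrable_pow_gaussianReal (μ : ℝ) (v : ℝ≥0) (k : ℕ) :
    Integrable (fun x => x ^ k) (gaussianReal μ v) :=
  (memLp_id_gaussianReal' (k : ENNReal) (by simp)).integrable_norm_pow'.mono' (by fun_prop)
    (.of_forall fun x => by simp)

theorem integrable_pow_mul_gaussianPDFReal (μ : ℝ) {v : ℝ≥0} (hv : v ≠ 0) (k : ℕ) :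
    Integrable fun x => x ^ k * gaussianPDFReal μ v x := by
  have h := integrable_pow_gaussianReal μ v k
  rw [gaussianReal_of_var_ne_zero _ hv, integrable_withDensity_iff_integrable_smul'
    (measurable_gaussianPDF μ v) (.of_forall fun _ => gaussianPDF_lt_top)] at h
  simpa only [toReal_gaussianPDF, smul_eq_mul, mul_comm] using h

theorem hasDerivAt_gaussianPDFReal (μ : ℝ) (v : ℝ≥0) (x : ℝ) :
    HasDerivAt (gaussianPDFReal μ v) (-((x - μ) / v * gaussianPDFReal μ v x)) x := by
  have hexponent : HasDerivAt (fun y => -(y - μ) ^ 2 / (2 * (v : ℝ))) (-((x - μ) / v)) x := by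
    convert! (((hasDerivAt_id x).sub_const μ).pow 2).neg.div_const (2 * (v : ℝ)) using 1
    simp [mul_div_mul_left, neg_div]
  rw [gaussianPDFReal_def]
  convert! hexponent.exp.const_mul (√(2 * Real.pi * v))⁻¹ using 1
  ring

/-- For `k = 0` the truncated exponent `k - 1` is harmless, being multiplied by `k`. -/
theorem integral_pow_succ_gaussianReal (k : ℕ) :
    ∫ x, x ^ (k + 1) ∂(gaussianReal 0 1) = k * ∫ x, x ^ (k - 1) ∂(gaussianReal 0 1) := by
  have hintegrable := integrable_pow_mul_gaussianPDFReal 0 one_ne_zero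
  have hparts := integral_mul_deriv_eq_deriv_mul_of_integrable
    (u := fun x : ℝ => x ^ k) (v := gaussianPDFReal 0 1)
    (u' := fun x => k * x ^ (k - 1)) (v' := fun x => -(x * gaussianPDFReal 0 1 x))
    (fun x _ => hasDerivAt_pow k x)
    (fun x _ => by simpa using hasDerivAt_gaussianPDFReal 0 1 x)
    ((hintegrable (k + 1)).neg.congr (.of_forall fun x => by simp [pow_succ, mul_assoc]))
    (((hintegrable (k - 1)).const_mul k).congr (.of_forall fun x => by simp [mul_assoc]))
    (hintegrable k)
  simp only [integral_gaussianReal_eq_integral_smul one_ne_zero, smul_eq_mul]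
  calc ∫ x, gaussianPDFReal 0 1 x * x ^ (k + 1)
      = -∫ x, x ^ k * -(x * gaussianPDFReal 0 1 x) := by
        rw [← integral_neg]
        congr with x
        ring
    _ = ∫ x, k * x ^ (k - 1) * gaussianPDFReal 0 1 x := by rw [hparts, neg_neg]
    _ = k * ∫ x, gaussianPDFReal 0 1 x * x ^ (k - 1) := by
        rw [← integral_const_mul]
        congr with x
        ring

variable {σ : Type*} [Fintype σ]

/-- The law of a family of independent standard Gaussian variables. -/
abbrev stdGaussianPi (σ : Type*) [Fintype σ] : Measure (σ → ℝ) :=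
  Measure.pi fun _ => gaussianReal 0 1

instance isOpenPosMeasure_gaussianReal_zero_one : (gaussianReal 0 1).IsOpenPosMeasure :=
  (gaussianReal_absolutelyContinuous' 0 one_ne_zero).isOpenPosMeasure

theorem integrable_eval_stdGaussianPi (f : MvPolynomial σ ℂ) :
    Integrable (fun x => f.eval fun i => (x i : ℂ)) (stdGaussianPi σ) := by
  induction f using MvPolynomial.induction_on' with
  | monomial m c =>
    simp_rw [MvPolynomial.eval_monomial, Finsupp.prod_fintype m _ fun _ => pow_zero _]
    refine .const_mul (.fintype_prod (f := fun i (y : ℝ) => (y : ℂ) ^ m i) fun i => ?_) c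
    simpa using (integrable_pow_gaussianReal 0 1 (m i)).ofReal (𝕜 := ℂ)
  | add p q hp hq =>
    simp_rw [map_add]
    exact hp.add hq

/-- The expectation of a complex polynomial in independent (real) standard Gaussian variables. -/
def gaussianExpectation (σ : Type*) [Fintype σ] : MvPolynomial σ ℂ →ₗ[ℂ] ℂ where
  toFun f := ∫ x, f.eval fun i => (x i : ℂ) ∂(stdGaussianPi σ)
  map_add' f g := by
    simp_rw [map_add]
    exact integral_add (integrable_eval_stdGaussianPi f) (integrable_eval_stdGaussianPi g)
  map_smul' c f := by
    simp_rw [MvPolynomial.smul_eval]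
    exact integral_const_mul _ _

theorem gaussianExpectation_monomial (m : σ →₀ ℕ) (c : ℂ) :
    gaussianExpectation σ (.monomial m c)
      = c * ∏ i, ((∫ x, x ^ m i ∂(gaussianReal 0 1) : ℝ) : ℂ) := by
  change ∫ x : σ → ℝ, MvPolynomial.eval _ _ ∂(stdGaussianPi σ) = _
  simp_rw [MvPolynomial.eval_monomial, Finsupp.prod_fintype m _ fun _ => pow_zero _]
  rw [integral_const_mul, integral_fintype_prod_eq_prod (f := fun i (y : ℝ) => (y : ℂ) ^ m i)]
  simp_rw [← Complex.ofReal_pow, integral_complex_ofReal]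

theorem gaussianExpectation_one : gaussianExpectation σ 1 = 1 := by
  rw [MvPolynomial.one_def, gaussianExpectation_monomial]
  simp

/-- Stein's identity, that is, Gaussian integration by parts. -/
theorem gaussianExpectation_X_mul (s : σ) (f : MvPolynomial σ ℂ) :
    gaussianExpectation σ (.X s * f) = gaussianExpectation σ (f.pderiv s) := by
  classical
  induction f using MvPolynomial.induction_on' with
  | monomial m c =>
    rw [MvPolynomial.pderiv_monomial, MvPolynomial.X, MvPolynomial.monomial_mul,
      gaussianExpectation_monomial, gaussianExpectation_monomial,
      ← Finset.mul_prod_erase _ _ (Finset.mem_univ s),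
      ← Finset.mul_prod_erase _ _ (Finset.mem_univ s)]
    have hother : ∀ i ∈ Finset.univ.erase s,
        ((∫ x, x ^ ((.single s 1 + m : σ →₀ ℕ) i) ∂(gaussianReal 0 1) : ℝ) : ℂ)
          = ((∫ x, x ^ ((m - .single s 1 : σ →₀ ℕ) i) ∂(gaussianReal 0 1) : ℝ) : ℂ) := by
      intro i hi
      simp [Finsupp.single_eq_of_ne' (Finset.ne_of_mem_erase hi).symm]
    rw [Finset.prod_congr rfl hother, Finsupp.add_apply, Finsupp.tsub_apply, Finsupp.single_eq_same,
      add_comm 1, integral_pow_succ_gaussianReal]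
    push_cast
    ring
  | add p q hp hq => rw [mul_add, map_add, hp, hq, map_add, map_add]

theorem gaussianExpectation_re_pos {f : MvPolynomial σ ℂ}
    (hf : ∀ x : σ → ℝ, 0 ≤ (f.eval fun i => (x i : ℂ)).re)
    {x₀ : σ → ℝ} (hx₀ : 0 < (f.eval fun i => (x₀ i : ℂ)).re) :
    0 < (gaussianExpectation σ f).re := by
  have hcont : Continuous fun x : σ → ℝ => (f.eval fun i => (x i : ℂ)).re :=
    Complex.continuous_re.comp (f.continuous_eval.comp (by fun_prop))
  have hre : (gaussianExpectation σ f).re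
      = ∫ x : σ → ℝ, (f.eval fun i => (x i : ℂ)).re ∂(stdGaussianPi σ) :=
    (integral_re (𝕜 := ℂ) (integrable_eval_stdGaussianPi f)).symm
  rw [hre, integral_pos_iff_support_of_nonneg hf (integrable_eval_stdGaussianPi f).re]
  exact hcont.isOpen_support.measure_pos _ ⟨x₀, hx₀.ne'⟩

end Gaussian

section EntrywiseCommute

open Matrix

variable {ι κ μ ν R : Type*} [Ring R]

/-- Every entry of `M` commutes with every entry of `N` up to the factor `c`. The sign rule for
matrices with anticommuting entries is the case `c = -1`. -/
def EntrywiseCommute (c : ℤ) (M : Matrix ι κ R) (N : Matrix μ ν R) : Prop :=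
  ∀ i j k l, M i j * N k l = c • (N k l * M i j)

namespace EntrywiseCommute

variable {c d : ℤ} {M : Matrix ι κ R} {N : Matrix μ ν R}

theorem symm_one (h : EntrywiseCommute 1 M N) : EntrywiseCommute 1 N M := fun i j k l => by
  simpa only [one_smul] using (h k l i j).symm

theorem map {S F : Type*} [Ring S] [FunLike F R S] [RingHomClass F R S]
    (h : EntrywiseCommute c M N) (f : F) :
    EntrywiseCommute c (M.map f) (N.map f) := fun i j k l => by
  simp only [map_apply, ← map_mul, h i j k l, map_zsmul]

theorem mul_right {ρ : Type*} [Fintype ν] {N' : Matrix ν ρ R} (h : EntrywiseCommute c M N)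
    (h' : EntrywiseCommute d M N') : EntrywiseCommute (c * d) M (N * N') := by
  intro i j k l
  simp_rw [mul_apply, Finset.mul_sum, Finset.sum_mul, Finset.smul_sum]
  refine Finset.sum_congr rfl fun r _ => ?_
  rw [← mul_assoc, h, smul_mul_assoc, mul_assoc, h', mul_smul_comm, mul_assoc, mul_smul]

theorem mul_left {ρ : Type*} [Fintype κ] {M' : Matrix κ ρ R} (h : EntrywiseCommute c M N)
    (h' : EntrywiseCommute d M' N) : EntrywiseCommute (c * d) (M * M') N := by
  intro i j k l
  simp_rw [mul_apply, Finset.mul_sum, Finset.sum_mul, Finset.smul_sum]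
  refine Finset.sum_congr rfl fun r _ => ?_
  rw [mul_assoc, h', mul_smul_comm, ← mul_assoc, h, smul_mul_assoc, mul_assoc, smul_smul, mul_comm]

theorem one_right [DecidableEq μ] (M : Matrix ι κ R) :
    EntrywiseCommute 1 M (1 : Matrix μ μ R) := by
  intro i j k l
  obtain rfl | h := eq_or_ne k l <;> simp [*]

theorem one_left [DecidableEq ι] (N : Matrix μ ν R) :
    EntrywiseCommute 1 (1 : Matrix ι ι R) N := by
  intro i j k l
  obtain rfl | h := eq_or_ne i j <;> simp [*]

theorem pow_right [Fintype μ] [DecidableEq μ] {N : Matrix μ μ R} (h : EntrywiseCommute c M N) :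
    ∀ k : ℕ, EntrywiseCommute (c ^ k) M (N ^ k)
  | 0 => by simpa only [pow_zero] using one_right M
  | k + 1 => by simpa only [pow_succ] using (h.pow_right k).mul_right h

theorem pow_left [Fintype ι] [DecidableEq ι] {M : Matrix ι ι R} (h : EntrywiseCommute c M N) :
    ∀ k : ℕ, EntrywiseCommute (c ^ k) (M ^ k) N
  | 0 => by simpa only [pow_zero] using one_left N
  | k + 1 => by simpa only [pow_succ] using (h.pow_left k).mul_left h

theorem pow_pow [Fintype ι] [DecidableEq ι] [Fintype μ] [DecidableEq μ] {M : Matrix ι ι R}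
    {N : Matrix μ μ R} (h : EntrywiseCommute c M N) (k l : ℕ) :
    EntrywiseCommute (c ^ (k * l)) (M ^ k) (N ^ l) := by
  simpa only [pow_mul] using (h.pow_left k).pow_right l

theorem transpose_mul [Fintype κ] {N : Matrix κ ν R} (h : EntrywiseCommute c M N) :
    (M * N)ᵀ = c • (Nᵀ * Mᵀ) := by
  ext i j
  simp only [transpose_apply, mul_apply, Matrix.smul_apply, Finset.smul_sum]
  exact Finset.sum_congr rfl fun r _ => h j r r i

theorem trace_mul [Fintype ι] [Fintype κ] {N : Matrix κ ι R} (h : EntrywiseCommute c M N) :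
    (M * N).trace = c • (N * M).trace := by
  simp only [trace, diag_apply, mul_apply, Finset.smul_sum]
  rw [Finset.sum_comm]
  exact Finset.sum_congr rfl fun j _ => Finset.sum_congr rfl fun i _ => h i j j i

theorem trace_mul_trace [Fintype ι] [Fintype μ] {M : Matrix ι ι R} {N : Matrix μ μ R}
    (h : EntrywiseCommute c M N) : M.trace * N.trace = c • (N.trace * M.trace) := by
  simp only [trace, diag_apply, Finset.sum_mul_sum, Finset.smul_sum]
  rw [Finset.sum_comm]
  exact Finset.sum_congr rfl fun j _ => Finset.sum_congr rfl fun i _ => h i i j j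

variable [Fintype ι] [DecidableEq ι] {a : Matrix ι ι R}

theorem transpose_pow (ha : EntrywiseCommute (-1) a a) (hskew : aᵀ = -a) (k : ℕ) :
    (a ^ k)ᵀ = (-1 : ℤ) ^ (k + 1).choose 2 • a ^ k := by
  induction k with
  | zero => simp
  | succ k ih =>
    rw [pow_succ, (ha.pow_left k).transpose_mul, ih, hskew, neg_mul, mul_smul_comm, ← pow_succ',
      ← pow_succ, Nat.choose_succ_succ' (k + 1), Nat.choose_one_right, smul_neg, smul_smul,
      ← pow_add, ← neg_smul, pow_add, pow_add]
    congr 1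
    ring

theorem trace_pow_eq_zero_of_odd_choose [IsAddTorsionFree R] (ha : EntrywiseCommute (-1) a a)
    (hskew : aᵀ = -a) {k : ℕ} (hk : Odd ((k + 1).choose 2)) : (a ^ k).trace = 0 := by
  have h := congrArg trace (ha.transpose_pow hskew k)
  rw [trace_transpose, hk.neg_one_pow, neg_one_smul, trace_neg] at h
  exact self_eq_neg.mp h

theorem trace_pow_succ_eq_zero_of_odd [IsAddTorsionFree R] (ha : EntrywiseCommute (-1) a a)
    {k : ℕ} (hk : Odd k) : (a ^ (k + 1)).trace = 0 := by
  have h := (ha.pow_right k).trace_mul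
  rw [← pow_succ, ← pow_succ', hk.neg_one_pow, neg_one_smul] at h
  exact self_eq_neg.mp h

theorem trace_pow_eq_zero_of_mod_four_ne_three [IsAddTorsionFree R]
    (ha : EntrywiseCommute (-1) a a) (hskew : aᵀ = -a) {k : ℕ} (hk₀ : k ≠ 0) (hk : k % 4 ≠ 3) :
    (a ^ k).trace = 0 := by
  obtain ⟨c, rfl | rfl | rfl⟩ : ∃ c, k = 4 * c + 3 + 1 ∨ k = 4 * c + 1 ∨ k = 4 * c + 2 := by
    rcases (by omega : k % 4 = 0 ∨ k % 4 = 1 ∨ k % 4 = 2) with h | h | h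
    exacts [⟨k / 4 - 1, by omega⟩, ⟨k / 4, by omega⟩, ⟨k / 4, by omega⟩]
  · exact ha.trace_pow_succ_eq_zero_of_odd ⟨2 * c + 1, by ring⟩
  · refine ha.trace_pow_eq_zero_of_odd_choose hskew ⟨4 * c ^ 2 + 3 * c, ?_⟩
    rw [Nat.choose_two_right, Nat.add_sub_cancel]
    exact Nat.div_eq_of_eq_mul_left two_pos (by ring)
  · refine ha.trace_pow_eq_zero_of_odd_choose hskew ⟨4 * c ^ 2 + 5 * c + 1, ?_⟩
    rw [Nat.choose_two_right, Nat.add_sub_cancel]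
    exact Nat.div_eq_of_eq_mul_left two_pos (by ring)

theorem trace_pow_mul_trace_pow (ha : EntrywiseCommute (-1) a a) {k l : ℕ} (hk : Odd k)
    (hl : Odd l) : (a ^ k).trace * (a ^ l).trace = -((a ^ l).trace * (a ^ k).trace) := by
  rw [(ha.pow_pow k l).trace_mul_trace, (hk.mul hl).neg_one_pow, neg_one_smul]

end EntrywiseCommute

end EntrywiseCommute

section PolynomialCoefficients

open TensorProduct

variable {σ R : Type*} [Ring R] [Algebra ℂ R]

/-- The partial derivative, acting on polynomials with coefficients in `R`. -/
def coeffPderiv (R : Type*) [Ring R] [Algebra ℂ R] (s : σ) :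
    (MvPolynomial σ ℂ ⊗[ℂ] R) →ₗ[ℂ] (MvPolynomial σ ℂ ⊗[ℂ] R) :=
  LinearMap.rTensor R (MvPolynomial.pderiv s).toLinearMap

/-- The expectation of a polynomial in independent standard Gaussian variables with coefficients
in `R`. -/
def coeffExpectation (σ R : Type*) [Fintype σ] [Ring R] [Algebra ℂ R] :
    (MvPolynomial σ ℂ ⊗[ℂ] R) →ₗ[ℂ] R :=
  (TensorProduct.lid ℂ R).toLinearMap ∘ₗ LinearMap.rTensor R (gaussianExpectation σ)

/-- Evaluation of a polynomial with coefficients in `R` at a scalar point. -/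
def coeffEval (R : Type*) [Ring R] [Algebra ℂ R] (x : σ → ℂ) :
    (MvPolynomial σ ℂ ⊗[ℂ] R) →ₐ[ℂ] R :=
  Algebra.TensorProduct.lift ((Algebra.ofId ℂ R).comp (MvPolynomial.aeval x)) (AlgHom.id ℂ R)
    fun _ r => Algebra.commutes _ r

/-- The polynomial obtained from one with coefficients in `R` by applying a linear functional to
each coefficient. -/
def coeffFunctional (σ : Type*) (l : R →ₗ[ℂ] ℂ) :
    (MvPolynomial σ ℂ ⊗[ℂ] R) →ₗ[ℂ] MvPolynomial σ ℂ :=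
  (TensorProduct.rid ℂ _).toLinearMap ∘ₗ LinearMap.lTensor _ l

/-- The variable `X s` as a polynomial with coefficients in `R`. -/
def coeffX (R : Type*) [Ring R] [Algebra ℂ R] (s : σ) : MvPolynomial σ ℂ ⊗[ℂ] R :=
  MvPolynomial.X s ⊗ₜ 1

/-- The constants in the polynomials with coefficients in `R`. -/
def coeffC (σ R : Type*) [Ring R] [Algebra ℂ R] : R →ₐ[ℂ] (MvPolynomial σ ℂ ⊗[ℂ] R) :=
  Algebra.TensorProduct.includeRight

theorem coeffX_comm (s : σ) (f : MvPolynomial σ ℂ ⊗[ℂ] R) : coeffX R s * f = f * coeffX R s := by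
  induction f using TensorProduct.induction_on with
  | zero => simp
  | tmul p r => simp [coeffX, Algebra.TensorProduct.tmul_mul_tmul, mul_comm]
  | add x y hx hy => rw [mul_add, add_mul, hx, hy]

theorem coeffPderiv_mul (s : σ) (f g : MvPolynomial σ ℂ ⊗[ℂ] R) :
    coeffPderiv R s (f * g) = coeffPderiv R s f * g + f * coeffPderiv R s g := by
  induction f using TensorProduct.induction_on with
  | zero => simp
  | tmul p r =>
    induction g using TensorProduct.induction_on with
    | zero => simp
    | tmul p' r' =>
      simp only [coeffPderiv, Algebra.TensorProduct.tmul_mul_tmul, LinearMap.rTensor_tmul,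
        Derivation.coeFn_coe, Derivation.leibniz, smul_eq_mul, TensorProduct.add_tmul]
      rw [add_comm, mul_comm p']
    | add x y hx hy =>
      simp only [mul_add, map_add, hx, hy]
      abel
  | add x y hx hy =>
    simp only [add_mul, map_add, hx, hy]
    abel

theorem coeffPderiv_coeffX [DecidableEq σ] (s t : σ) :
    coeffPderiv R s (coeffX R t) = if t = s then 1 else 0 := by
  rw [coeffPderiv, coeffX, LinearMap.rTensor_tmul, Derivation.coeFn_coe, MvPolynomial.pderiv_X,
    Pi.single_apply]
  split_ifs <;> simp_all [Algebra.TensorProduct.one_def]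

theorem coeffPderiv_coeffC (s : σ) (r : R) : coeffPderiv R s (coeffC σ R r) = 0 := by
  simp [coeffPderiv, coeffC]

section Expectation

variable [Fintype σ]

theorem coeffExpectation_X_mul (s : σ) (f : MvPolynomial σ ℂ ⊗[ℂ] R) :
    coeffExpectation σ R (coeffX R s * f) = coeffExpectation σ R (coeffPderiv R s f) := by
  induction f using TensorProduct.induction_on with
  | zero => simp
  | tmul p r =>
    simp [coeffExpectation, coeffX, coeffPderiv, Algebra.TensorProduct.tmul_mul_tmul,
      gaussianExpectation_X_mul]
  | add x y hx hy => rw [mul_add, map_add, hx, hy, map_add, map_add]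

theorem coeffExpectation_C_mul (c : R) (f : MvPolynomial σ ℂ ⊗[ℂ] R) :
    coeffExpectation σ R (coeffC σ R c * f) = c * coeffExpectation σ R f := by
  induction f using TensorProduct.induction_on with
  | zero => simp
  | tmul p r => simp [coeffExpectation, coeffC, Algebra.TensorProduct.tmul_mul_tmul]
  | add x y hx hy => rw [mul_add, map_add, hx, hy, map_add, mul_add]

theorem coeffExpectation_one : coeffExpectation σ R 1 = 1 := by
  simp [coeffExpectation, Algebra.TensorProduct.one_def, gaussianExpectation_one]

theorem gaussianExpectation_coeffFunctional (l : R →ₗ[ℂ] ℂ) (F : MvPolynomial σ ℂ ⊗[ℂ] R) :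
    gaussianExpectation σ (coeffFunctional σ l F) = l (coeffExpectation σ R F) := by
  induction F using TensorProduct.induction_on with
  | zero => simp
  | tmul p r => simp [coeffFunctional, coeffExpectation, mul_comm]
  | add F G hF hG => rw [map_add, map_add, hF, hG, map_add, map_add]

end Expectation

theorem coeffEval_tmul (x : σ → ℂ) (p : MvPolynomial σ ℂ) (r : R) :
    coeffEval R x (p ⊗ₜ r) = p.eval x • r := by
  rw [Algebra.smul_def, ← MvPolynomial.coe_aeval_eq_eval]
  exact Algebra.TensorProduct.lift_tmul _ _ _ p r

@[simp]
theorem coeffEval_coeffX (x : σ → ℂ) (s : σ) :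
    coeffEval R x (coeffX R s) = algebraMap ℂ R (x s) := by
  rw [coeffX, coeffEval_tmul, MvPolynomial.eval_X, Algebra.algebraMap_eq_smul_one]

@[simp]
theorem coeffEval_coeffC (x : σ → ℂ) (r : R) : coeffEval R x (coeffC σ R r) = r := by
  rw [coeffC, Algebra.TensorProduct.includeRight_apply, coeffEval_tmul, map_one, one_smul]

theorem eval_coeffFunctional (l : R →ₗ[ℂ] ℂ) (x : σ → ℂ) (F : MvPolynomial σ ℂ ⊗[ℂ] R) :
    (coeffFunctional σ l F).eval x = l (coeffEval R x F) := by
  induction F using TensorProduct.induction_on with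
  | zero => simp
  | tmul p r => simp [coeffFunctional, coeffEval_tmul, MvPolynomial.smul_eval, mul_comm]
  | add F G hF hG => rw [map_add, map_add, hF, hG, map_add, map_add]

end PolynomialCoefficients

theorem adjoin_toSubmodule_le_iSup_span_pow {R A : Type*} [CommSemiring R] [Semiring A]
    [Algebra R A] (s : Set A) :
    Subalgebra.toSubmodule (Algebra.adjoin R s) ≤ ⨆ n : ℕ, Submodule.span R s ^ n := by
  rw [Algebra.adjoin_eq_span, Submodule.span_le]
  intro x hx
  suffices ∃ n : ℕ, x ∈ Submodule.span R s ^ n from Submodule.mem_iSup_of_mem this.choose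
    this.choose_spec
  induction hx using Submonoid.closure_induction_left with
  | one => exact ⟨0, Submodule.one_le.mp le_rfl⟩
  | mul_left x hx y _ hy =>
    obtain ⟨n, hn⟩ := hy
    exact ⟨n + 1, pow_succ' (Submodule.span R s) n ▸
      Submodule.mul_mem_mul (Submodule.subset_span hx) hn⟩

section Words

open TensorProduct Matrix

variable {ι R : Type*} [Ring R] [Algebra ℂ R]

/-- The generic matrix `X`, with independent variables as entries. -/
def genericMatrix (ι R : Type*) [Ring R] [Algebra ℂ R] :
    Matrix ι ι (MvPolynomial (ι × ι) ℂ ⊗[ℂ] R) :=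
  .of fun i j => coeffX R (i, j)

theorem entrywiseCommute_genericMatrix {μ ν : Type*}
    (M : Matrix μ ν (MvPolynomial (ι × ι) ℂ ⊗[ℂ] R)) :
    EntrywiseCommute 1 (genericMatrix ι R) M := fun i j k l => by
  rw [one_smul]
  exact coeffX_comm (i, j) (M k l)

variable [Fintype ι] [DecidableEq ι]

/-- The matrix `A ^ k * X`, where `X` is the generic matrix. -/
def halfWord (a : Matrix ι ι R) (k : ℕ) : Matrix ι ι (MvPolynomial (ι × ι) ℂ ⊗[ℂ] R) :=
  a.map (coeffC (ι × ι) R) ^ k * genericMatrix ι R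

/-- The matrix `Xᵀ * A ^ k * X`, where `X` is the generic matrix. -/
def word (a : Matrix ι ι R) (k : ℕ) : Matrix ι ι (MvPolynomial (ι × ι) ℂ ⊗[ℂ] R) :=
  (genericMatrix ι R)ᵀ * halfWord a k

/-- The span of the entries of the words with positive exponent. -/
def wordSpan (a : Matrix ι ι R) : Submodule ℂ (MvPolynomial (ι × ι) ℂ ⊗[ℂ] R) :=
  .span ℂ {w | ∃ k i j, word a (k + 1) i j = w}

/-- The subalgebra generated by the traces of the positive powers. -/
def traceAlgebra (a : Matrix ι ι R) : Subalgebra ℂ R :=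
  Algebra.adjoin ℂ (Set.range fun k : ℕ => (a ^ (k + 1)).trace)

variable (a : Matrix ι ι R)

theorem word_succ_mem_wordSpan (k : ℕ) (i j : ι) : word a (k + 1) i j ∈ wordSpan a :=
  Submodule.subset_span ⟨k, i, j, rfl⟩

theorem coeffC_pow_apply (k : ℕ) (i j : ι) :
    (a.map (coeffC (ι × ι) R) ^ k) i j = coeffC (ι × ι) R ((a ^ k) i j) := by
  rw [← AlgHom.mapMatrix_apply, ← map_pow, AlgHom.mapMatrix_apply, map_apply]

theorem coeffPderiv_halfWord (k : ℕ) (p i q j : ι) :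
    coeffPderiv R (p, i) (halfWord a k q j)
      = if i = j then coeffC (ι × ι) R ((a ^ k) q p) else 0 := by
  simp only [halfWord, mul_apply, coeffC_pow_apply, genericMatrix, of_apply, map_sum,
    coeffPderiv_mul, coeffPderiv_coeffC, zero_mul, zero_add, coeffPderiv_coeffX, Prod.mk.injEq,
    mul_ite, mul_one, mul_zero, ite_and]
  rw [Finset.sum_ite_eq' Finset.univ p]
  simp [eq_comm]

theorem coeffPderiv_word (l : ℕ) (p i i' j' : ι) :
    coeffPderiv R (p, i) (word a l i' j')
      = (if i = i' then halfWord a l p j' else 0) + if i = j' then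
        ((genericMatrix ι R)ᵀ * a.map (coeffC (ι × ι) R) ^ l) i' p else 0 := by
  rw [word, mul_apply, mul_apply]
  simp only [coeffC_pow_apply, transpose_apply, genericMatrix, of_apply,
    map_sum, coeffPderiv_mul, coeffPderiv_halfWord, coeffPderiv_coeffX, Finset.sum_add_distrib,
    Prod.mk.injEq, ite_mul, one_mul, zero_mul, mul_ite, mul_zero, ite_and]
  congr 1
  · rw [Finset.sum_ite_eq' Finset.univ p]
    simp [eq_comm]
  · split_ifs <;> simp

/-- The first-order differential operator `∑ p, (A ^ k * X) p j * ∂ / ∂ X p i` that appears when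
integrating `word a k i j * y` by parts. -/
def wordDerivation (k : ℕ) (i j : ι) :
    (MvPolynomial (ι × ι) ℂ ⊗[ℂ] R) →ₗ[ℂ] (MvPolynomial (ι × ι) ℂ ⊗[ℂ] R) :=
  ∑ p, LinearMap.mulLeft ℂ (halfWord a k p j) ∘ₗ coeffPderiv R (p, i)

theorem wordDerivation_apply (k : ℕ) (i j : ι) (y : MvPolynomial (ι × ι) ℂ ⊗[ℂ] R) :
    wordDerivation a k i j y = ∑ p, halfWord a k p j * coeffPderiv R (p, i) y := by
  simp [wordDerivation]

theorem coeffExpectation_word_mul (k : ℕ) (i j : ι) (y : MvPolynomial (ι × ι) ℂ ⊗[ℂ] R) :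
    coeffExpectation (ι × ι) R (word a k i j * y)
      = (if i = j then (a ^ k).trace * coeffExpectation (ι × ι) R y else 0)
        + coeffExpectation (ι × ι) R (wordDerivation a k i j y) := by
  have hparts (p : ι) : coeffExpectation (ι × ι) R
      ((genericMatrix ι R)ᵀ i p * halfWord a k p j * y)
        = (if i = j then (a ^ k) p p * coeffExpectation (ι × ι) R y else 0)
          + coeffExpectation (ι × ι) R (halfWord a k p j * coeffPderiv R (p, i) y) := by
    rw [mul_assoc, transpose_apply, genericMatrix, of_apply, coeffExpectation_X_mul,
      coeffPderiv_mul, map_add, coeffPderiv_halfWord]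
    split_ifs <;> simp [coeffExpectation_C_mul]
  rw [word, mul_apply, Finset.sum_mul, map_sum, Finset.sum_congr rfl fun p _ => hparts p,
    Finset.sum_add_distrib, wordDerivation_apply, map_sum]
  split_ifs <;> simp [trace, Finset.sum_mul]

variable {a}

theorem entrywiseCommute_halfWord_rowWord (ha : EntrywiseCommute (-1) a a) (k l : ℕ) :
    EntrywiseCommute ((-1) ^ (k * l)) (halfWord a k)
      ((genericMatrix ι R)ᵀ * a.map (coeffC (ι × ι) R) ^ l) := by
  have hX {μ ν : Type _} (M : Matrix μ ν (MvPolynomial (ι × ι) ℂ ⊗[ℂ] R)) :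
      EntrywiseCommute 1 (genericMatrix ι R)ᵀ M := fun i j => entrywiseCommute_genericMatrix M j i
  have hA := (ha.map (coeffC (ι × ι) R)).pow_pow k l
  simpa only [halfWord, one_mul, mul_one] using
    ((hX _).symm_one.mul_right hA).mul_left (entrywiseCommute_genericMatrix _)

theorem entrywiseCommute_halfWord_word (ha : EntrywiseCommute (-1) a a) (k l : ℕ) :
    EntrywiseCommute ((-1) ^ (k * l)) (halfWord a k) (word a l) := by
  rw [word, ← mul_one ((-1 : ℤ) ^ (k * l)), halfWord.eq_def a l, ← Matrix.mul_assoc]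
  exact (entrywiseCommute_halfWord_rowWord ha k l).mul_right
    (entrywiseCommute_genericMatrix _).symm_one

theorem halfWord_transpose (ha : EntrywiseCommute (-1) a a) (hskew : aᵀ = -a) (k : ℕ) :
    (halfWord a k)ᵀ = (-1 : ℤ) ^ (k + 1).choose 2 •
      ((genericMatrix ι R)ᵀ * a.map (coeffC (ι × ι) R) ^ k) := by
  have hA := (ha.map (coeffC (ι × ι) R)).transpose_pow
    (by rw [← transpose_map, hskew]; ext; simp) k
  rw [halfWord, (entrywiseCommute_genericMatrix _).symm_one.transpose_mul, one_smul,
    ← Matrix.mul_smul, ← hA]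

theorem rowWord_mul_halfWord (k l : ℕ) :
    (genericMatrix ι R)ᵀ * a.map (coeffC (ι × ι) R) ^ k * halfWord a l = word a (k + l) := by
  rw [word, halfWord, halfWord, pow_add]
  simp only [Matrix.mul_assoc]

theorem wordDerivation_word (ha : EntrywiseCommute (-1) a a) (hskew : aᵀ = -a) (k l : ℕ)
    (i j i' j' : ι) :
    wordDerivation a k i j (word a l i' j')
      = (if i = i' then (-1 : ℤ) ^ (k + 1).choose 2 • word a (k + l) j j' else 0)
        + if i = j' then (-1 : ℤ) ^ (k * l) • word a (k + l) i' j else 0 := by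
  simp_rw [wordDerivation_apply, coeffPderiv_word, mul_add, Finset.sum_add_distrib]
  congr 1
  · split_ifs
    · rw [← rowWord_mul_halfWord, ← Matrix.smul_apply, ← Matrix.smul_mul,
        ← halfWord_transpose ha hskew, mul_apply]
      rfl
    · simp
  · split_ifs
    · rw [add_comm k, ← rowWord_mul_halfWord, mul_apply, Finset.smul_sum]
      exact Finset.sum_congr rfl fun p _ => entrywiseCommute_halfWord_rowWord ha k l p j i' p
    · simp

theorem wordDerivation_word_mul (ha : EntrywiseCommute (-1) a a) (k l : ℕ) (i j i' j' : ι)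
    (y : MvPolynomial (ι × ι) ℂ ⊗[ℂ] R) :
    wordDerivation a k i j (word a l i' j' * y)
      = wordDerivation a k i j (word a l i' j') * y
        + (-1 : ℤ) ^ (k * l) • (word a l i' j' * wordDerivation a k i j y) := by
  simp_rw [wordDerivation_apply, coeffPderiv_mul, mul_add, Finset.sum_add_distrib, Finset.sum_mul,
    Finset.mul_sum, Finset.smul_sum, ← mul_assoc,
    entrywiseCommute_halfWord_word ha k l _ j i' j', smul_mul_assoc]

theorem wordDerivation_word_mem_wordSpan (ha : EntrywiseCommute (-1) a a) (hskew : aᵀ = -a)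
    (k l : ℕ) (i j i' j' : ι) :
    wordDerivation a k i j (word a (l + 1) i' j') ∈ wordSpan a := by
  rw [wordDerivation_word ha hskew, ← add_assoc]
  refine add_mem ?_ ?_ <;> split_ifs
  exacts [zsmul_mem (word_succ_mem_wordSpan a _ _ _) _, zero_mem _,
    zsmul_mem (word_succ_mem_wordSpan a _ _ _) _, zero_mem _]

theorem wordSpan_pow_le_comap_wordDerivation (ha : EntrywiseCommute (-1) a a) (hskew : aᵀ = -a)
    (k : ℕ) (i j : ι) (r : ℕ) :
    wordSpan a ^ r ≤ (wordSpan a ^ r).comap (wordDerivation a k i j) := by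
  induction r with
  | zero =>
    rw [Submodule.pow_zero, Submodule.one_le, Submodule.mem_comap, wordDerivation_apply,
      ← map_one (coeffC (ι × ι) R)]
    simp_rw [coeffPderiv_coeffC, mul_zero, Finset.sum_const_zero]
    exact zero_mem _
  | succ r ih =>
    have hsucc : wordSpan a ^ (r + 1) = wordSpan a * wordSpan a ^ r :=
      pow_succ' (wordSpan a) r
    rw [hsucc, Submodule.mul_le]
    intro w hw y hy
    have hDy : wordDerivation a k i j y ∈ wordSpan a ^ r := ih hy
    suffices wordSpan a ≤ ((wordSpan a * wordSpan a ^ r).comap (wordDerivation a k i j)).comap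
      (LinearMap.mulRight ℂ y) from this hw
    rw [wordSpan, Submodule.span_le]
    rintro _ ⟨l, i', j', rfl⟩
    change wordDerivation a k i j (word a (l + 1) i' j' * y) ∈ wordSpan a * wordSpan a ^ r
    rw [wordDerivation_word_mul ha]
    exact add_mem (Submodule.mul_mem_mul (wordDerivation_word_mem_wordSpan ha hskew k l _ _ _ _) hy)
      (zsmul_mem (Submodule.mul_mem_mul (word_succ_mem_wordSpan a _ _ _) hDy) _)

theorem wordSpan_pow_le_comap_coeffExpectation (ha : EntrywiseCommute (-1) a a) (hskew : aᵀ = -a)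
    (r : ℕ) :
    wordSpan a ^ r ≤ (Subalgebra.toSubmodule (traceAlgebra a)).comap
      (coeffExpectation (ι × ι) R) := by
  induction r with
  | zero =>
    rw [Submodule.pow_zero, Submodule.one_le, Submodule.mem_comap, coeffExpectation_one]
    exact one_mem (traceAlgebra a)
  | succ r ih =>
    have hsucc : wordSpan a ^ (r + 1) = wordSpan a * wordSpan a ^ r :=
      pow_succ' (wordSpan a) r
    rw [hsucc, Submodule.mul_le]
    intro w hw y hy
    suffices wordSpan a ≤ ((Subalgebra.toSubmodule (traceAlgebra a)).comap
      (coeffExpectation (ι × ι) R)).comap (LinearMap.mulRight ℂ y) from this hw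
    rw [wordSpan, Submodule.span_le]
    rintro _ ⟨k, i, j, rfl⟩
    change coeffExpectation (ι × ι) R (word a (k + 1) i j * y) ∈ traceAlgebra a
    rw [coeffExpectation_word_mul]
    refine add_mem ?_ (ih (wordSpan_pow_le_comap_wordDerivation ha hskew _ i j r hy))
    split_ifs
    exacts [mul_mem (Algebra.subset_adjoin ⟨k, rfl⟩) (ih hy), zero_mem _]

theorem coeffExpectation_mem_traceAlgebra (ha : EntrywiseCommute (-1) a a) (hskew : aᵀ = -a)
    {y : MvPolynomial (ι × ι) ℂ ⊗[ℂ] R}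
    (hy : y ∈ Algebra.adjoin ℂ (Set.range fun p : ι × ι => word a 1 p.1 p.2)) :
    coeffExpectation (ι × ι) R y ∈ traceAlgebra a := by
  have hspan : Submodule.span ℂ (Set.range fun p : ι × ι => word a 1 p.1 p.2) ≤ wordSpan a :=
    Submodule.span_mono (by rintro _ ⟨p, rfl⟩; exact ⟨0, p.1, p.2, rfl⟩)
  exact (adjoin_toSubmodule_le_iSup_span_pow _).trans (iSup_le fun r =>
    (pow_le_pow_left' hspan r).trans
      (wordSpan_pow_le_comap_coeffExpectation ha hskew r)) hy

theorem coeffEval_word_one (a : Matrix ι ι R) (x : ι × ι → ℂ) (i j : ι) :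
    coeffEval R x (word a 1 i j) = ∑ p, ∑ q, (x (p, i) * x (q, j)) • a p q := by
  simp_rw [word, halfWord, pow_one, mul_apply, map_sum, map_mul, map_sum, map_mul,
    map_apply, coeffEval_coeffC, transpose_apply, genericMatrix, of_apply,
    coeffEval_coeffX, Finset.mul_sum, ← Algebra.commutes, ← mul_assoc, ← map_mul,
    ← Algebra.smul_def]

end Words

section HermitianForm

open Matrix Module Set Set.powersetCard

variable {I M : Type*} [AddCommGroup M] [Module ℂ M]

/-- The Hermitian form for which the basis `b` is orthonormal, linear in its second argument. -/
def basisHermitian [Fintype I] (b : Basis I ℂ M) (x : M) : M →ₗ[ℂ] ℂ :=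
  ∑ i, star (b.repr x i) • b.coord i

theorem basisHermitian_apply [Fintype I] (b : Basis I ℂ M) (x y : M) :
    basisHermitian b x y = star ⇑(b.repr x) ⬝ᵥ ⇑(b.repr y) := by
  simp [basisHermitian, dotProduct]

theorem basisHermitian_self_re [Fintype I] (b : Basis I ℂ M) (x : M) :
    (basisHermitian b x x).re = ∑ i, Complex.normSq (b.repr x i) := by
  rw [basisHermitian_apply, dotProduct, Complex.re_sum]
  refine Finset.sum_congr rfl fun i _ => ?_
  rw [Pi.star_apply, Complex.star_def, ← Complex.normSq_eq_conj_mul_self, Complex.ofReal_re]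

theorem basisHermitian_self_re_nonneg [Fintype I] (b : Basis I ℂ M) (x : M) :
    0 ≤ (basisHermitian b x x).re := by
  rw [basisHermitian_self_re]
  exact Finset.sum_nonneg fun i _ => Complex.normSq_nonneg _

theorem basisHermitian_self_re_pos [Fintype I] (b : Basis I ℂ M) {x : M} (hx : x ≠ 0) :
    0 < (basisHermitian b x x).re := by
  rw [basisHermitian_self_re]
  obtain ⟨i, hi⟩ : ∃ i, b.repr x i ≠ 0 := by
    by_contra! h
    exact hx (b.ext_elem fun i => by rw [h i, map_zero, Finsupp.zero_apply])
  exact Finset.sum_pos' (fun i _ => Complex.normSq_nonneg _)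
    ⟨i, Finset.mem_univ i, Complex.normSq_pos.mpr hi⟩

/-- The linear maps `f` and `f'` are adjoint with respect to the Hermitian form attached to the
basis `b`: their matrices in this basis, which may be infinite, are conjugate transposes. -/
def IsBasisAdjoint (b : Basis I ℂ M) (f f' : M →ₗ[ℂ] M) : Prop :=
  ∀ i j, b.repr (f (b i)) j = star (b.repr (f' (b j)) i)

theorem IsBasisAdjoint.basisHermitian_eq [Fintype I] {b : Basis I ℂ M} {f f' : M →ₗ[ℂ] M}
    (h : IsBasisAdjoint b f f') (x y : M) :
    basisHermitian b x (f y) = basisHermitian b (f' x) y := by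
  classical
  have hmatrix : LinearMap.toMatrix b b f = (LinearMap.toMatrix b b f')ᴴ := by
    ext i j
    rw [LinearMap.toMatrix_apply, h, conjTranspose_apply, LinearMap.toMatrix_apply]
  rw [basisHermitian_apply, basisHermitian_apply, ← LinearMap.toMatrix_mulVec_repr b b f,
    ← LinearMap.toMatrix_mulVec_repr b b f', hmatrix, star_mulVec, dotProduct_mulVec]

theorem IsBasisAdjoint.reindex {J : Type*} {b : Basis I ℂ M} {f f' : M →ₗ[ℂ] M}
    (h : IsBasisAdjoint b f f') (ε : I ≃ J) : IsBasisAdjoint (b.reindex ε) f f' := by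
  intro i j
  simpa using h (ε.symm i) (ε.symm j)

theorem IsBasisAdjoint.exteriorPower [LinearOrder I] {b : Basis I ℂ M} {f f' : M →ₗ[ℂ] M}
    (h : IsBasisAdjoint b f f') (k : ℕ) :
    IsBasisAdjoint (b.exteriorPower k) (exteriorPower.map k f) (exteriorPower.map k f') := by
  intro s t
  simp only [exteriorPower.basis_repr_apply, exteriorPower.basis_apply,
    exteriorPower.ιMulti_family, exteriorPower.map_apply_ιMulti,
    exteriorPower.ιMultiDual_apply_ιMulti]
  rw [← det_conjTranspose]
  congr 1
  ext i j
  exact h _ _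

theorem exteriorAlgebra_map_coe {R M N : Type*} [CommRing R] [AddCommGroup M] [Module R M]
    [AddCommGroup N] [Module R N] (f : M →ₗ[R] N) (k : ℕ) (z : ⋀[R]^k M) :
    ExteriorAlgebra.map f (z : ExteriorAlgebra R M)
      = (exteriorPower.map k f z : ⋀[R]^k N) := by
  have h : (ExteriorAlgebra.map f).toLinearMap ∘ₗ (⋀[R]^k M).subtype
      = (⋀[R]^k N).subtype ∘ₗ exteriorPower.map k f := by
    refine exteriorPower.linearMap_ext ?_
    ext v
    simp
  exact LinearMap.congr_fun h z

theorem exteriorAlgebra_basis_repr_coe {R M : Type*} [CommRing R] [Nontrivial R]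
    [AddCommGroup M] [Module R M] [LinearOrder I] (b : Basis I R M) (k : ℕ) (z : ⋀[R]^k M) :
    b.ExteriorAlgebra.repr (z : ExteriorAlgebra R M)
      = ((b.exteriorPower k).repr z).mapDomain Subtype.val := by
  have h : b.ExteriorAlgebra.repr.toLinearMap ∘ₗ (⋀[R]^k M).subtype
      = Finsupp.lmapDomain R R (Subtype.val : powersetCard I k → Finset I) ∘ₗ
        (b.exteriorPower k).repr.toLinearMap := by
    refine (b.exteriorPower k).ext fun s => ?_
    simp only [LinearMap.comp_apply, Submodule.subtype_apply, LinearEquiv.coe_coe,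
      Basis.repr_self, Finsupp.lmapDomain_apply, Finsupp.mapDomain_single]
    rw [← ExteriorAlgebra.basis_eq_coe_basis, Basis.repr_self]
  exact LinearMap.congr_fun h z

theorem exteriorAlgebra_basis_repr_map_basis [LinearOrder I] (b : Basis I ℂ M) (f : M →ₗ[ℂ] M)
    {k : ℕ} (s t : powersetCard I k) :
    b.ExteriorAlgebra.repr (ExteriorAlgebra.map f (b.ExteriorAlgebra s)) t
      = (b.exteriorPower k).repr (exteriorPower.map k f (b.exteriorPower k s)) t := by
  rw [ExteriorAlgebra.basis_eq_coe_basis, exteriorAlgebra_map_coe, exteriorAlgebra_basis_repr_coe,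
    Finsupp.mapDomain_apply Subtype.val_injective]

theorem exteriorAlgebra_basis_repr_map_basis_of_card_ne [LinearOrder I] (b : Basis I ℂ M)
    (f : M →ₗ[ℂ] M) {s t : Finset I} (hst : s.card ≠ t.card) :
    b.ExteriorAlgebra.repr (ExteriorAlgebra.map f (b.ExteriorAlgebra s)) t = 0 := by
  have hs : b.ExteriorAlgebra s = (b.exteriorPower s.card ⟨s, rfl⟩ : ExteriorAlgebra ℂ M) :=
    ExteriorAlgebra.basis_eq_coe_basis (s := ⟨s, rfl⟩) ..
  rw [hs, exteriorAlgebra_map_coe, exteriorAlgebra_basis_repr_coe,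
    Finsupp.mapDomain_of_notMem_range]
  rintro ⟨u, rfl⟩
  exact hst u.2.symm

theorem IsBasisAdjoint.exteriorAlgebra [LinearOrder I] {b : Basis I ℂ M} {f f' : M →ₗ[ℂ] M}
    (h : IsBasisAdjoint b f f') :
    IsBasisAdjoint b.ExteriorAlgebra (ExteriorAlgebra.map f).toLinearMap
      (ExteriorAlgebra.map f').toLinearMap := by
  intro s t
  simp only [AlgHom.toLinearMap_apply]
  by_cases hst : s.card = t.card
  · obtain ⟨k, hs⟩ : ∃ k, s.card = k := ⟨_, rfl⟩
    lift t to powersetCard I k using hst.symm.trans hs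
    lift s to powersetCard I k using hs
    rw [exteriorAlgebra_basis_repr_map_basis, exteriorAlgebra_basis_repr_map_basis]
    exact h.exteriorPower _ s t
  · rw [exteriorAlgebra_basis_repr_map_basis_of_card_ne b f hst,
      exteriorAlgebra_basis_repr_map_basis_of_card_ne b f' (Ne.symm hst), star_zero]

end HermitianForm

section MatrixAction

open Matrix Module

variable {V : Type*} [AddCommGroup V] [Module ℂ V] {n : ℕ}

theorem ι_mul_ι_comm {R M : Type*} [CommRing R] [AddCommGroup M] [Module R M] (x y : M) :
    ExteriorAlgebra.ι R x * ExteriorAlgebra.ι R y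
      = -(ExteriorAlgebra.ι R y * ExteriorAlgebra.ι R x) :=
  eq_neg_of_add_eq_zero_left (ExteriorAlgebra.ι_add_mul_swap x y)

theorem ιMulti_two_sum {R M κ : Type*} [CommRing R] [AddCommGroup M] [Module R M] [Fintype κ]
    (v : κ → M) (c d : κ → R) :
    exteriorPower.ιMulti R 2 ![∑ p, c p • v p, ∑ q, d q • v q]
      = ∑ p, ∑ q, (c p * d q) • exteriorPower.ιMulti R 2 ![v p, v q] := by
  classical
  have hvec : ![∑ p, c p • v p, ∑ q, d q • v q] = fun i => ∑ p, ![c, d] i p • v p :=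
    List.ofFn_inj.mp rfl
  rw [hvec, ← AlternatingMap.coe_multilinearMap, MultilinearMap.map_sum, ← Fintype.sum_prod_type',
    ← (finTwoArrowEquiv κ).sum_comp]
  refine Finset.sum_congr rfl fun r _ => ?_
  rw [MultilinearMap.map_smul_univ, Fin.prod_univ_two]
  congr 2
  exact List.ofFn_inj.mp rfl

theorem lambdaTwoAction_comp (f g : V →ₗ[ℂ] V) :
    lambdaTwoAction (f ∘ₗ g) = (lambdaTwoAction f).comp (lambdaTwoAction g) := by
  rw [lambdaTwoAction, exteriorPower.map_comp, ← ExteriorAlgebra.map_comp_map]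
  rfl

theorem lambdaTwoAction_id : lambdaTwoAction (LinearMap.id : V →ₗ[ℂ] V) = AlgHom.id ℂ _ := by
  rw [lambdaTwoAction, exteriorPower.map_id, ExteriorAlgebra.map_id]

theorem matrixA_apply (e : Fin n → V) (i j : Fin n) :
    matrixA e i j = ExteriorAlgebra.ι ℂ (exteriorPower.ιMulti ℂ 2 ![e i, e j]) :=
  rfl

theorem map_matrixA {M : Type*} [AddCommGroup M] [Module ℂ M] (f : V →ₗ[ℂ] M) (e : Fin n → V) :
    (matrixA e).map (ExteriorAlgebra.map (exteriorPower.map 2 f)) = matrixA (f ∘ e) := by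
  ext i j
  rw [map_apply, matrixA_apply, ExteriorAlgebra.map_apply_ι, exteriorPower.map_apply_ιMulti]
  exact congrArg (fun v => ExteriorAlgebra.ι ℂ (exteriorPower.ιMulti ℂ 2 v))
    (List.ofFn_inj.mp rfl)

/-- A matrix of vectors, regarded as a matrix over their exterior algebra. -/
def oddMatrix {ι κ U : Type*} [AddCommGroup U] [Module ℂ U] (w : Matrix ι κ U) :
    Matrix ι κ (ExteriorAlgebra ℂ U) :=
  w.map (ExteriorAlgebra.ι ℂ)

theorem entrywiseCommute_oddMatrix {ι κ μ ν U : Type*} [AddCommGroup U] [Module ℂ U]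
    (w : Matrix ι κ U) (w' : Matrix μ ν U) :
    EntrywiseCommute (-1) (oddMatrix w) (oddMatrix w') := fun i j k l => by
  rw [neg_one_zsmul]
  exact ι_mul_ι_comm _ _

theorem transpose_oddMatrix {ι U : Type*} [AddCommGroup U] [Module ℂ U] {w : Matrix ι ι U}
    (hw : wᵀ = -w) : (oddMatrix w)ᵀ = -oddMatrix w := by
  rw [oddMatrix, ← transpose_map, hw, Matrix.map_neg _ (map_neg _)]

/-- The matrix of the bivectors `e_i ∧ e_j`. -/
def wedgeMatrix (e : Fin n → V) : Matrix (Fin n) (Fin n) (⋀[ℂ]^2 V) :=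
  of fun i j => exteriorPower.ιMulti ℂ 2 ![e i, e j]

theorem transpose_wedgeMatrix (e : Fin n → V) : (wedgeMatrix e)ᵀ = -wedgeMatrix e := by
  ext1 i j
  have h := (exteriorPower.ιMulti ℂ 2).map_swap ![e i, e j] (i := 0) (j := 1) (by decide)
  rw [transpose_apply, neg_apply, wedgeMatrix, of_apply, of_apply, ← h]
  exact congrArg (exteriorPower.ιMulti ℂ 2) (List.ofFn_inj.mp rfl)

theorem transpose_matrixA (e : Fin n → V) : (matrixA e)ᵀ = -matrixA e :=
  transpose_oddMatrix (transpose_wedgeMatrix e)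

theorem entrywiseCommute_matrixA (e : Fin n → V) :
    EntrywiseCommute (-1) (matrixA e) (matrixA e) :=
  entrywiseCommute_oddMatrix (wedgeMatrix e) (wedgeMatrix e)

/-- The action of a matrix on `Λ(Λ₂(V))` through a basis of `V`. -/
def matrixAction (e : Basis (Fin n) ℂ V) (G : Matrix (Fin n) (Fin n) ℂ) :
    ExtAlgLambdaTwo V →ₐ[ℂ] ExtAlgLambdaTwo V :=
  lambdaTwoAction (toLin e e G)

theorem matrixAction_mul (e : Basis (Fin n) ℂ V) (G H : Matrix (Fin n) (Fin n) ℂ) :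
    matrixAction e (G * H) = (matrixAction e G).comp (matrixAction e H) := by
  rw [matrixAction, toLin_mul e e e, lambdaTwoAction_comp]
  rfl

theorem matrixAction_one (e : Basis (Fin n) ℂ V) : matrixAction e 1 = AlgHom.id ℂ _ := by
  rw [matrixAction, toLin_one, lambdaTwoAction_id]

theorem matrixAction_matrixA (e : Basis (Fin n) ℂ V) (G : Matrix (Fin n) (Fin n) ℂ)
    (i j : Fin n) :
    matrixAction e G (matrixA e i j) = ∑ p, ∑ q, (G p i * G q j) • matrixA e p q := by
  have h : matrixAction e G (matrixA e i j) = matrixA (toLin e e G ∘ e) i j :=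
    congrFun₂ (map_matrixA (toLin e e G) e) i j
  rw [h]
  simp only [matrixA_apply, Function.comp_apply, toLin_self, ιMulti_two_sum, map_sum, map_smul]

/-- The basis of `Λ₂(V)` attached to a basis of `V`, numbered arbitrarily. -/
def lambdaTwoBasis (e : Basis (Fin n) ℂ V) : Basis (Fin (n.choose 2)) ℂ (⋀[ℂ]^2 V) :=
  (e.exteriorPower 2).reindex <| Finite.equivFinOfCardEq <| by
    rw [Set.powersetCard.card, Nat.card_fin]

/-- The basis of `Λ(Λ₂(V))` attached to a basis of `V`. -/
def extAlgBasis (e : Basis (Fin n) ℂ V) :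
    Basis (Finset (Fin (n.choose 2))) ℂ (ExtAlgLambdaTwo V) :=
  (lambdaTwoBasis e).ExteriorAlgebra

theorem basisHermitian_matrixAction (e : Basis (Fin n) ℂ V) (G : Matrix (Fin n) (Fin n) ℂ)
    (x y : ExtAlgLambdaTwo V) :
    basisHermitian (extAlgBasis e) x (matrixAction e G y)
      = basisHermitian (extAlgBasis e) (matrixAction e Gᴴ x) y := by
  have hG : IsBasisAdjoint e (toLin e e G) (toLin e e Gᴴ) := fun i j => by
    simp [toLin_self, Finsupp.single_apply]
  exact ((hG.exteriorPower 2).reindex _).exteriorAlgebra.basisHermitian_eq x y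

end MatrixAction

section AnticommutingLift

open Module

variable {K R I M : Type*} [Field K] [NeZero (2 : K)] [Ring R] [Algebra K R] [Finite I]
  [AddCommGroup M] [Module K M] {x : I → R}

theorem constr_mul_self_of_anticommute (b : Basis I K M) (hx : ∀ i j, x i * x j = -(x j * x i))
    (v : M) : b.constr K x v * b.constr K x v = 0 := by
  cases nonempty_fintype I
  have hneg : b.constr K x v * b.constr K x v = -(b.constr K x v * b.constr K x v) := by
    simp_rw [Basis.constr_apply_fintype, Finset.sum_mul_sum, smul_mul_smul_comm]
    conv_lhs => rw [Finset.sum_comm]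
    simp_rw [← Finset.sum_neg_distrib, ← smul_neg, ← hx]
    exact Finset.sum_congr rfl fun i _ => Finset.sum_congr rfl fun j _ => by rw [mul_comm]
  have htwo : (2 : K) • (b.constr K x v * b.constr K x v) = 0 := by
    rw [two_smul]
    exact add_eq_zero_iff_eq_neg.mpr hneg
  exact (smul_eq_zero_iff_right two_ne_zero).mp htwo

/-- The homomorphism from an exterior algebra that sends a basis to given anticommuting
elements. -/
def anticommutingLift (b : Basis I K M) (hx : ∀ i j, x i * x j = -(x j * x i)) :
    ExteriorAlgebra K M →ₐ[K] R :=
  ExteriorAlgebra.lift K ⟨b.constr K x, constr_mul_self_of_anticommute b hx⟩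

theorem anticommutingLift_ι_basis (b : Basis I K M) (hx : ∀ i j, x i * x j = -(x j * x i))
    (i : I) : anticommutingLift b hx (ExteriorAlgebra.ι K (b i)) = x i := by
  rw [anticommutingLift, ExteriorAlgebra.lift_ι_apply, Basis.constr_basis]

theorem range_anticommutingLift (b : Basis I K M) (hx : ∀ i j, x i * x j = -(x j * x i)) :
    (anticommutingLift b hx).range = Algebra.adjoin K (Set.range x) := by
  refine le_antisymm ?_ (Algebra.adjoin_le ?_)
  · rintro _ ⟨z, rfl⟩
    change anticommutingLift b hx z ∈ _
    induction z using ExteriorAlgebra.induction with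
    | algebraMap r =>
      exact (AlgHom.commutes (anticommutingLift b hx) r).symm ▸ Subalgebra.algebraMap_mem _ r
    | ι v =>
      cases nonempty_fintype I
      rw [anticommutingLift, ExteriorAlgebra.lift_ι_apply, Basis.constr_apply_fintype]
      exact sum_mem fun i _ => Subalgebra.smul_mem _
        (Algebra.subset_adjoin (Set.mem_range_self i)) _
    | mul y z hy hz => exact (map_mul (anticommutingLift b hx) y z).symm ▸ mul_mem hy hz
    | add y z hy hz => exact (map_add (anticommutingLift b hx) y z).symm ▸ add_mem hy hz
  · rintro _ ⟨i, rfl⟩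
    exact ⟨ExteriorAlgebra.ι K (b i), anticommutingLift_ι_basis b hx i⟩

end AnticommutingLift

section Averaging

open Matrix Module TensorProduct

theorem entrywiseCommute_word_one {ι R : Type*} [Ring R] [Algebra ℂ R] [Fintype ι] [DecidableEq ι]
    {a : Matrix ι ι R} (ha : EntrywiseCommute (-1) a a) :
    EntrywiseCommute (-1) (word a 1) (word a 1) := by
  have htranspose : EntrywiseCommute 1 (genericMatrix ι R)ᵀ (word a 1) :=
    fun i j => entrywiseCommute_genericMatrix (word a 1) j i
  simpa only [word, one_mul, mul_one, pow_one]
    using htranspose.mul_left (entrywiseCommute_halfWord_word ha 1 1)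

variable {V : Type*} [AddCommGroup V] [Module ℂ V] {n : ℕ}

/-- The action of the generic matrix on `Λ(Λ₂(V))`, with polynomials in the entries as
coefficients. -/
def genericAction (e : Basis (Fin n) ℂ V) :
    ExtAlgLambdaTwo V →ₐ[ℂ] MvPolynomial (Fin n × Fin n) ℂ ⊗[ℂ] ExtAlgLambdaTwo V :=
  anticommutingLift (e.exteriorPower 2)
    (x := fun s => word (matrixA e) 1 (Set.powersetCard.ofFinEmbEquiv.symm s 0)
      (Set.powersetCard.ofFinEmbEquiv.symm s 1))
    fun s t => by
      simpa only [neg_one_zsmul]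
        using entrywiseCommute_word_one (entrywiseCommute_matrixA e) _ _ _ _

theorem genericAction_mem_adjoin (e : Basis (Fin n) ℂ V) (x : ExtAlgLambdaTwo V) :
    genericAction e x
      ∈ Algebra.adjoin ℂ (Set.range fun p : Fin n × Fin n => word (matrixA e) 1 p.1 p.2) := by
  have hx : genericAction e x ∈ (genericAction e).range := ⟨x, rfl⟩
  rw [genericAction, range_anticommutingLift] at hx
  refine Algebra.adjoin_mono ?_ hx
  rintro _ ⟨s, rfl⟩
  exact ⟨(_, _), rfl⟩

theorem ι_exteriorPower_two_basis (e : Basis (Fin n) ℂ V) (s : Set.powersetCard (Fin n) 2) :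
    ExteriorAlgebra.ι ℂ (e.exteriorPower 2 s)
      = matrixA e (Set.powersetCard.ofFinEmbEquiv.symm s 0)
        (Set.powersetCard.ofFinEmbEquiv.symm s 1) := by
  rw [exteriorPower.basis_apply, exteriorPower.ιMulti_family, matrixA_apply]
  exact congrArg (fun v => ExteriorAlgebra.ι ℂ (exteriorPower.ιMulti ℂ 2 v))
    (List.ofFn_inj.mp rfl)

theorem coeffEval_genericAction (e : Basis (Fin n) ℂ V) (y : Fin n × Fin n → ℂ)
    (x : ExtAlgLambdaTwo V) :
    coeffEval _ y (genericAction e x) = matrixAction e (of fun i j => y (i, j)) x := by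
  have h : (coeffEval _ y).comp (genericAction e) = matrixAction e (of fun i j => y (i, j)) := by
    refine ExteriorAlgebra.hom_ext ((e.exteriorPower 2).ext fun s => ?_)
    simp only [LinearMap.comp_apply, AlgHom.toLinearMap_apply, AlgHom.comp_apply]
    rw [genericAction, anticommutingLift_ι_basis, coeffEval_word_one, ι_exteriorPower_two_basis,
      matrixAction_matrixA]
    rfl
  exact DFunLike.congr_fun h x

/-- The average of the action on `Λ(Λ₂(V))` over matrices with independent standard Gaussian
entries. -/
def gaussianAverage (e : Basis (Fin n) ℂ V) : ExtAlgLambdaTwo V →ₗ[ℂ] ExtAlgLambdaTwo V :=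
  coeffExpectation _ _ ∘ₗ (genericAction e).toLinearMap

theorem gaussianAverage_mem_traceAlgebra (e : Basis (Fin n) ℂ V) (x : ExtAlgLambdaTwo V) :
    gaussianAverage e x ∈ traceAlgebra (matrixA e) :=
  coeffExpectation_mem_traceAlgebra (entrywiseCommute_matrixA e) (transpose_matrixA e)
    (genericAction_mem_adjoin e x)

end Averaging

section Polar

open Matrix
open scoped MatrixOrder Matrix.Norms.L2Operator

variable {ι : Type*} [Fintype ι]

theorem exists_fourth_root {P : Matrix ι ι ℝ} (hP : P.PosSemidef) :
    ∃ S : Matrix ι ι ℝ, Sᵀ = S ∧ (S * S) * (S * S) = P := by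
  classical
  have hS : 0 ≤ CFC.sqrt (CFC.sqrt P) := CFC.sqrt_nonneg _
  refine ⟨CFC.sqrt (CFC.sqrt P), ?_, ?_⟩
  · rw [← conjTranspose_eq_transpose_of_trivial]
    exact hS.posSemidef.isHermitian
  · rw [CFC.sqrt_mul_sqrt_self _ (CFC.sqrt_nonneg _), CFC.sqrt_mul_sqrt_self _ hP.nonneg]

variable [DecidableEq ι]

theorem exists_eq_orthogonal_mul_mul_self {G : Matrix ι ι ℝ} (hG : G.det ≠ 0) :
    ∃ O S : Matrix ι ι ℝ, Oᵀ * O = 1 ∧ Sᵀ = S ∧ G = O * (S * S) := by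
  have hpos : (Gᵀ * G).PosSemidef := by
    simpa only [conjTranspose_eq_transpose_of_trivial] using posSemidef_conjTranspose_mul_self G
  obtain ⟨S, hS, hS4⟩ := exists_fourth_root hpos
  have hdet : IsUnit (S * S).det := by
    refine isUnit_of_mul_isUnit_left (y := (S * S).det) ?_
    rw [← det_mul, hS4, det_mul, det_transpose]
    exact (mul_ne_zero hG hG).isUnit
  refine ⟨G * (S * S)⁻¹, S, ?_, hS, (nonsing_inv_mul_cancel_right _ _ hdet).symm⟩
  calc (G * (S * S)⁻¹)ᵀ * (G * (S * S)⁻¹)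
      = (S * S)⁻¹ * (Gᵀ * G) * (S * S)⁻¹ := by
        rw [transpose_mul, transpose_nonsing_inv, transpose_mul, hS]
        simp only [Matrix.mul_assoc]
    _ = 1 := by
        rw [← hS4, nonsing_inv_mul_cancel_left _ _ hdet, mul_nonsing_inv _ hdet]

/-- The matrices `t + G` with `t` not an eigenvalue of `-G` are invertible and approximate `G`. -/
theorem of_forall_det_ne_zero {p : Matrix ι ι ℝ → Prop} (hp : IsClosed {G | p G})
    (h : ∀ G, G.det ≠ 0 → p G) (G : Matrix ι ι ℝ) : p G := by
  let shift (t : ℝ) : Matrix ι ι ℝ := scalar ι t - -G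
  have hshift : Continuous shift :=
    (Continuous.matrix_diagonal (continuous_pi fun _ => continuous_id)).sub continuous_const
  have hdense : Dense {t : ℝ | (-G).charpoly.IsRoot t}ᶜ := by
    rw [Set.compl_eq_univ_sdiff]
    exact dense_univ.sdiff_finite
      (Polynomial.finite_setOfPred_isRoot (charpoly_monic _).ne_zero)
  have hsub : {t : ℝ | (-G).charpoly.IsRoot t}ᶜ ⊆ shift ⁻¹' {G | p G} := fun t ht =>
    h _ (by rwa [← eval_charpoly])
  have hzero : p (shift 0) := (hp.preimage hshift).closure_subset_iff.mpr hsub (hdense 0)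
  simpa only [shift, map_zero, zero_sub, neg_neg] using hzero

end Polar

section Generation

open Matrix Module

variable {V : Type*} [AddCommGroup V] [Module ℂ V] {n : ℕ}

variable {B : LinearMap.BilinForm ℂ V} {e : Basis (Fin n) ℂ V}

theorem mem_orthogonalGroupOf_iff_transpose_mul_toMatrix
    (he : ∀ i j, B (e i) (e j) = if i = j then 1 else 0) (g : V ≃ₗ[ℂ] V) :
    g ∈ orthogonalGroupOf B ↔
      (LinearMap.toMatrix e e (g : V →ₗ[ℂ] V))ᵀ * LinearMap.toMatrix e e (g : V →ₗ[ℂ] V) = 1 := by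
  have hB : LinearMap.BilinForm.toMatrix e B = 1 := by
    ext i j
    rw [LinearMap.BilinForm.toMatrix_apply, he, one_apply]
  have hcomp : g ∈ orthogonalGroupOf B ↔ B.comp (g : V →ₗ[ℂ] V) (g : V →ₗ[ℂ] V) = B :=
    (LinearMap.ext_iff₂ (f := B.comp (g : V →ₗ[ℂ] V) (g : V →ₗ[ℂ] V)) (g := B)).symm
  rw [hcomp, ← (LinearMap.BilinForm.toMatrix e).injective.eq_iff,
    LinearMap.BilinForm.toMatrix_comp e e, hB, Matrix.mul_one]

theorem matrixAction_eq_self (he : ∀ i j, B (e i) (e j) = if i = j then 1 else 0)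
    {x : ExtAlgLambdaTwo V} (hx : x ∈ orthogonalInvariants B) {O : Matrix (Fin n) (Fin n) ℂ}
    (hO : Oᵀ * O = 1) : matrixAction e O x = x := by
  let g : V ≃ₗ[ℂ] V := toLinOfInv e e (mul_eq_one_comm.mp hO) hO
  have hg : (g : V →ₗ[ℂ] V) = toLin e e O := rfl
  have hmem : g ∈ orthogonalGroupOf B := by
    rwa [mem_orthogonalGroupOf_iff_transpose_mul_toMatrix he, hg, LinearMap.toMatrix_toLin]
  exact hx g hmem

theorem map_matrixAction_matrixA (e : Basis (Fin n) ℂ V) (G : Matrix (Fin n) (Fin n) ℂ) :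
    (matrixA e).map (matrixAction e G)
      = Gᵀ.map (algebraMap ℂ _) * matrixA e * G.map (algebraMap ℂ _) := by
  ext i j
  simp_rw [map_apply, matrixAction_matrixA, mul_apply, Finset.sum_mul, map_apply, transpose_apply]
  rw [Finset.sum_comm]
  refine Finset.sum_congr rfl fun q _ => Finset.sum_congr rfl fun p _ => ?_
  rw [mul_assoc, ← Algebra.commutes, ← mul_assoc, ← map_mul, ← Algebra.smul_def]

theorem matrixAction_trace_pow (e : Basis (Fin n) ℂ V) {O : Matrix (Fin n) (Fin n) ℂ}
    (hO : Oᵀ * O = 1) (k : ℕ) :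
    matrixAction e O (matrixA e ^ k).trace = (matrixA e ^ k).trace := by
  let P : (Matrix (Fin n) (Fin n) (ExtAlgLambdaTwo V))ˣ :=
    Units.map (algebraMap ℂ (ExtAlgLambdaTwo V)).mapMatrix.toMonoidHom
      ⟨Oᵀ, O, hO, mul_eq_one_comm.mp hO⟩
  have hconj : (matrixA e).map (matrixAction e O) = P.val * matrixA e * P⁻¹.val :=
    map_matrixAction_matrixA e O
  have hcomm : EntrywiseCommute 1 (P.val * matrixA e ^ k) P⁻¹.val :=
    fun i j p q => by rw [one_smul]; exact (Algebra.commutes (O p q) _).symm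
  calc matrixAction e O (matrixA e ^ k).trace
      = (((matrixA e).map (matrixAction e O)) ^ k).trace := by
        rw [AddMonoidHom.map_trace, ← AlgHom.mapMatrix_apply, map_pow, AlgHom.mapMatrix_apply]
    _ = (P.val * matrixA e ^ k * P⁻¹.val).trace := by rw [hconj, Units.conj_pow]
    _ = (matrixA e ^ k).trace := by
        rw [hcomm.trace_mul, one_smul, ← Matrix.mul_assoc, Units.inv_mul, Matrix.one_mul]

theorem traceAlgebra_le_orthogonalInvariants
    (he : ∀ i j, B (e i) (e j) = if i = j then 1 else 0) :
    traceAlgebra (matrixA e) ≤ orthogonalInvariants B := by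
  refine Algebra.adjoin_le ?_
  rintro _ ⟨k, rfl⟩ g hg
  rw [mem_orthogonalGroupOf_iff_transpose_mul_toMatrix he] at hg
  simpa only [matrixAction, toLin_toMatrix] using matrixAction_trace_pow e hg (k + 1)

theorem basisHermitian_matrixAction_re_nonneg
    (he : ∀ i j, B (e i) (e j) = if i = j then 1 else 0)
    {x : ExtAlgLambdaTwo V} (hx : x ∈ orthogonalInvariants B) {G : Matrix (Fin n) (Fin n) ℝ}
    (hG : G.det ≠ 0) :
    0 ≤ (basisHermitian (extAlgBasis e) x (matrixAction e (G.map Complex.ofRealHom) x)).re := by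
  obtain ⟨O, S, hO, hS, rfl⟩ := exists_eq_orthogonal_mul_mul_self hG
  have hstar (A : Matrix (Fin n) (Fin n) ℝ) :
      (A.map Complex.ofRealHom)ᴴ = Aᵀ.map Complex.ofRealHom := by
    ext i j
    exact Complex.conj_ofReal _
  have hOt : matrixAction e (Oᵀ.map Complex.ofRealHom) x = x := by
    refine matrixAction_eq_self he hx ?_
    rw [← transpose_map, ← Matrix.map_mul, transpose_transpose, mul_eq_one_comm.mp hO,
      Matrix.map_one _ (map_zero _) (map_one _)]
  rw [Matrix.map_mul, Matrix.map_mul, matrixAction_mul, AlgHom.comp_apply,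
    basisHermitian_matrixAction, hstar, hOt, matrixAction_mul, AlgHom.comp_apply,
    basisHermitian_matrixAction, hstar, hS]
  exact basisHermitian_self_re_nonneg _ _

theorem basisHermitian_gaussianAverage_re_pos
    (he : ∀ i j, B (e i) (e j) = if i = j then 1 else 0)
    {x : ExtAlgLambdaTwo V} (hx : x ∈ orthogonalInvariants B) (hx₀ : x ≠ 0) :
    0 < (basisHermitian (extAlgBasis e) x (gaussianAverage e x)).re := by
  let f := coeffFunctional (Fin n × Fin n) (basisHermitian (extAlgBasis e) x) (genericAction e x)
  let entries (G : Matrix (Fin n) (Fin n) ℝ) (s : Fin n × Fin n) : ℂ := (G s.1 s.2 : ℝ)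
  have heval (G : Matrix (Fin n) (Fin n) ℝ) : f.eval (entries G)
      = basisHermitian (extAlgBasis e) x (matrixAction e (G.map Complex.ofRealHom) x) := by
    rw [eval_coeffFunctional, coeffEval_genericAction]
    rfl
  have hcont : Continuous fun G => (f.eval (entries G)).re :=
    Complex.continuous_re.comp (f.continuous_eval.comp (by fun_prop))
  have hnonneg (G : Matrix (Fin n) (Fin n) ℝ) : 0 ≤ (f.eval (entries G)).re :=
    of_forall_det_ne_zero (isClosed_le continuous_const hcont)
      (fun G hG => heval G ▸ basisHermitian_matrixAction_re_nonneg he hx hG) G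
  have hone : 0 < (f.eval (entries 1)).re := by
    rw [heval, Matrix.map_one _ (map_zero _) (map_one _), matrixAction_one]
    exact basisHermitian_self_re_pos _ hx₀
  have hpos := gaussianExpectation_re_pos (f := f) (fun y => hnonneg (of fun i j => y (i, j))) hone
  rwa [gaussianExpectation_coeffFunctional] at hpos

/-- The Gaussian average maps the invariants injectively, hence surjectively, to themselves. -/
theorem traceAlgebra_eq_orthogonalInvariants
    (he : ∀ i j, B (e i) (e j) = if i = j then 1 else 0) :
    traceAlgebra (matrixA e) = orthogonalInvariants B := by
  refine le_antisymm (traceAlgebra_le_orthogonalInvariants he) fun x hx => ?_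
  have : Module.Finite ℂ (ExtAlgLambdaTwo V) := .of_basis (extAlgBasis e)
  let W : Subalgebra.toSubmodule (orthogonalInvariants B) →ₗ[ℂ]
      Subalgebra.toSubmodule (orthogonalInvariants B) :=
    (gaussianAverage e).restrict fun y _ =>
      traceAlgebra_le_orthogonalInvariants he (gaussianAverage_mem_traceAlgebra e y)
  have hinj : Function.Injective W := by
    refine LinearMap.ker_eq_bot.mp (LinearMap.ker_eq_bot'.mpr fun y hy => ?_)
    by_contra hy₀
    have hpos := basisHermitian_gaussianAverage_re_pos he y.2 (Subtype.coe_ne_coe.mpr hy₀)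
    have hzero : gaussianAverage e y = 0 := congrArg Subtype.val hy
    rw [hzero, map_zero, Complex.zero_re] at hpos
    exact lt_irrefl 0 hpos
  obtain ⟨y, hy⟩ := LinearMap.injective_iff_surjective.mp hinj ⟨x, hx⟩
  have hyx : gaussianAverage e y = x := congrArg Subtype.val hy
  exact hyx ▸ gaussianAverage_mem_traceAlgebra e y

end Generation

section Pfaffian

open Matrix

variable {ι : Type*}

/-- Splits off two points from a type, in order to write matrices in blocks. -/
def pairSumCompl [DecidableEq ι] {i j : ι} (hij : i ≠ j) :
    Fin 2 ⊕ {k // k ≠ i ∧ k ≠ j} ≃ ι :=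
  Equiv.ofBijective (Sum.elim ![i, j] Subtype.val) <| by
    refine ⟨(injective_pair_iff_ne.mpr hij).sumElim Subtype.val_injective fun p k => ?_,
      fun k => ?_⟩
    · fin_cases p
      exacts [k.2.1.symm, k.2.2.symm]
    · by_cases hi : k = i
      · exact ⟨.inl 0, hi.symm⟩
      by_cases hj : k = j
      · exact ⟨.inl 1, hj.symm⟩
      exact ⟨.inr ⟨k, hi, hj⟩, rfl⟩

theorem transpose_schurComplement_of_skew {R κ : Type*} [CommRing R] [Fintype ι] [DecidableEq ι]
    {A : Matrix ι ι R} [Invertible A] (hA : Aᵀ = -A) (B : Matrix ι κ R) {D : Matrix κ κ R}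
    (hD : Dᵀ = -D) : (D - -Bᵀ * ⅟A * B)ᵀ = -(D - -Bᵀ * ⅟A * B) := by
  have hinv : (⅟A)ᵀ = -⅟A := by
    rw [invOf_eq_nonsing_inv, transpose_nonsing_inv, hA]
    exact inv_eq_left_inv (by rw [neg_mul_neg, ← invOf_eq_nonsing_inv, invOf_mul_self])
  simp only [transpose_sub, transpose_mul, transpose_neg, transpose_transpose, hinv, hD,
    Matrix.neg_mul, Matrix.mul_neg, Matrix.mul_assoc, neg_neg, neg_sub]
  abel

theorem isSquare_det_of_skew {K : Type*} [Field K] [NeZero (2 : K)] [Fintype ι] [DecidableEq ι]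
    {X : Matrix ι ι K} (hX : Xᵀ = -X) : IsSquare X.det := by
  induction hN : Fintype.card ι using Nat.strong_induction_on generalizing ι with
  | _ N ih =>
    obtain rfl | hX₀ := eq_or_ne X 0
    · cases isEmpty_or_nonempty ι
      · rw [det_isEmpty]
        exact IsSquare.one
      · rw [det_zero]
        exact IsSquare.zero
    have hswap (k l : ι) : X l k = -X k l := congrFun₂ hX k l
    have hdiag (k : ι) : X k k = 0 := by
      have htwo : 2 * X k k = 0 := by linear_combination hswap k k
      exact (mul_eq_zero.mp htwo).resolve_left two_ne_zero
    obtain ⟨i, j, hij⟩ : ∃ i j, X i j ≠ 0 := by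
      by_contra! h
      exact hX₀ (Matrix.ext h)
    have hne : i ≠ j := fun h => hij (h ▸ hdiag i)
    let Y := X.submatrix (pairSumCompl hne) (pairSumCompl hne)
    have hA : Y.toBlocks₁₁ᵀ = -Y.toBlocks₁₁ := Matrix.ext fun _ _ => hswap _ _
    have hC : Y.toBlocks₂₁ = -Y.toBlocks₁₂ᵀ := Matrix.ext fun _ _ => hswap _ _
    have hD : Y.toBlocks₂₂ᵀ = -Y.toBlocks₂₂ := Matrix.ext fun _ _ => hswap _ _
    have hdet : Y.toBlocks₁₁.det = X i j * X i j := by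
      rw [det_fin_two]
      change X i i * X j j - X i j * X j i = _
      rw [hdiag i, hswap i j, zero_mul, zero_sub, mul_neg, neg_neg]
    let _ : Invertible Y.toBlocks₁₁ :=
      invertibleOfIsUnitDet _ (hdet ▸ (mul_ne_zero hij hij).isUnit)
    have hcard : Fintype.card {k // k ≠ i ∧ k ≠ j} < N :=
      hN ▸ Fintype.card_subtype_lt (x := i) (fun h => h.1 rfl)
    rw [← det_submatrix_equiv_self (pairSumCompl hne) X, ← fromBlocks_toBlocks (X.submatrix _ _),
      det_fromBlocks₁₁, hC, hdet]
    exact (IsSquare.mul_self _).mul (ih _ hcard (transpose_schurComplement_of_skew hA _ hD) rfl)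

/-- The matrix `(X (i, j) - X (j, i))` over the polynomial ring. -/
def genericSkew (ι : Type*) : Matrix ι ι (MvPolynomial (ι × ι) ℂ) :=
  of fun i j => MvPolynomial.X (i, j) - MvPolynomial.X (j, i)

theorem transpose_genericSkew (ι : Type*) : (genericSkew ι)ᵀ = -genericSkew ι :=
  Matrix.ext fun _ _ => (neg_sub _ _).symm

theorem map_aeval_genericSkew {S : Type*} [CommRing S] [Algebra ℂ S] {X : Matrix ι ι S}
    (hX : Xᵀ = -X) :
    (genericSkew ι).map (MvPolynomial.aeval fun s : ι × ι => (1 / 2 : ℂ) • X s.1 s.2) = X := by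
  ext i j
  have hswap : X j i = -X i j := congrFun₂ hX i j
  simp only [genericSkew, map_apply, of_apply, map_sub, MvPolynomial.aeval_X, hswap, smul_neg,
    sub_neg_eq_add, ← add_smul]
  norm_num

variable [Fintype ι] [DecidableEq ι]

theorem isSquare_det_genericSkew (ι : Type*) [Fintype ι] [DecidableEq ι] :
    IsSquare (genericSkew ι).det := by
  let c := algebraMap (MvPolynomial (ι × ι) ℂ) (FractionRing (MvPolynomial (ι × ι) ℂ))
  have hc : Function.Injective c := IsFractionRing.injective _ _
  have : CharZero (FractionRing (MvPolynomial (ι × ι) ℂ)) := charZero_of_injective_algebraMap hc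
  have hskew : (c.mapMatrix (genericSkew ι))ᵀ = -c.mapMatrix (genericSkew ι) := by
    rw [RingHom.mapMatrix_apply, ← transpose_map, transpose_genericSkew,
      Matrix.map_neg _ (map_neg c)]
  obtain ⟨d, hd⟩ := isSquare_det_of_skew hskew
  rw [← RingHom.map_det] at hd
  obtain ⟨p, hp⟩ := IsIntegrallyClosed.exists_algebraMap_eq_of_isIntegral_pow
    (R := MvPolynomial (ι × ι) ℂ) two_pos (pow_two d ▸ hd ▸ isIntegral_algebraMap)
  exact ⟨p, hc (by rw [map_mul, hd, hp])⟩

/-- A square root of the determinant of the generic skew-symmetric matrix: the Pfaffian, up to an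
unspecified sign. -/
def pfaffianPolynomial (ι : Type*) [Fintype ι] [DecidableEq ι] : MvPolynomial (ι × ι) ℂ :=
  (isSquare_det_genericSkew ι).choose

variable {S : Type*} [CommRing S] [Algebra ℂ S]

/-- The Pfaffian of a skew-symmetric matrix, up to a sign that depends only on its index type. The
generic skew-symmetric matrix `(X (i, j) - X (j, i))` specializes to `X` at `X / 2`. -/
def pfaffian (X : Matrix ι ι S) : S :=
  MvPolynomial.aeval (fun s : ι × ι => (1 / 2 : ℂ) • X s.1 s.2) (pfaffianPolynomial ι)

theorem map_pfaffian {T : Type*} [CommRing T] [Algebra ℂ T] (f : S →ₐ[ℂ] T) (X : Matrix ι ι S) :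
    f (pfaffian X) = pfaffian (X.map f) := by
  rw [pfaffian, MvPolynomial.comp_aeval_apply, pfaffian]
  simp only [map_smul, map_apply]

theorem pfaffian_mul_self {X : Matrix ι ι S} (hX : Xᵀ = -X) :
    pfaffian X * pfaffian X = X.det := by
  rw [pfaffian, ← map_mul, pfaffianPolynomial, ← (isSquare_det_genericSkew ι).choose_spec,
    AlgHom.map_det, AlgHom.mapMatrix_apply, map_aeval_genericSkew hX]

theorem pfaffian_conj_sq (g : Matrix ι ι S) {X : Matrix ι ι S} (hX : Xᵀ = -X) :
    pfaffian (g * X * gᵀ) * pfaffian (g * X * gᵀ)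
      = (g.det * pfaffian X) * (g.det * pfaffian X) := by
  have hskew : (g * X * gᵀ)ᵀ = -(g * X * gᵀ) := by
    rw [transpose_mul, transpose_mul, transpose_transpose, hX, Matrix.neg_mul, Matrix.mul_neg,
      Matrix.mul_assoc]
  rw [pfaffian_mul_self hskew, det_mul, det_mul, det_transpose, ← pfaffian_mul_self hX]
  ring

/-- Both sides have the same square, and agree for `g = 1`; in the generic case this determines
the sign, because the polynomial ring is a domain. -/
theorem pfaffian_conj (g : Matrix ι ι S) {X : Matrix ι ι S} (hX : Xᵀ = -X) :
    pfaffian (g * X * gᵀ) = g.det * pfaffian X := by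
  let P := MvPolynomial ((ι × ι) ⊕ (ι × ι)) ℂ
  let gU : Matrix ι ι P := of fun i j => MvPolynomial.X (Sum.inl (i, j))
  let XU : Matrix ι ι P := (genericSkew ι).map (MvPolynomial.rename Sum.inr)
  have hXU : XUᵀ = -XU := by
    rw [← transpose_map, transpose_genericSkew, Matrix.map_neg _ (map_neg _)]
  let spec (h : Matrix ι ι S) : P →ₐ[ℂ] S := MvPolynomial.aeval
    (Sum.elim (fun s => h s.1 s.2) fun s => (1 / 2 : ℂ) • X s.1 s.2)
  have hspec_g (h : Matrix ι ι S) : gU.map (spec h) = h :=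
    Matrix.ext fun i j => MvPolynomial.aeval_X _ _
  have hspec_X (h : Matrix ι ι S) : XU.map (spec h) = X := by
    conv_rhs => rw [← map_aeval_genericSkew hX]
    ext i j
    exact MvPolynomial.aeval_rename _ _ _
  have hspec_left (h : Matrix ι ι S) :
      spec h (pfaffian (gU * XU * gUᵀ)) = pfaffian (h * X * hᵀ) := by
    rw [map_pfaffian, Matrix.map_mul, Matrix.map_mul, transpose_map, hspec_g, hspec_X]
  have hspec_right (h : Matrix ι ι S) : spec h (gU.det * pfaffian XU) = h.det * pfaffian X := by
    rw [map_mul, map_pfaffian, AlgHom.map_det, AlgHom.mapMatrix_apply, hspec_g, hspec_X]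
  obtain hU | hU := mul_self_eq_mul_self_iff.mp (pfaffian_conj_sq gU hXU)
  · rw [← hspec_left, hU, hspec_right]
  · have hneg (h : Matrix ι ι S) : pfaffian (h * X * hᵀ) = -(h.det * pfaffian X) := by
      rw [← hspec_left, hU, map_neg, hspec_right]
    have hzero : pfaffian X = 0 := by
      have hone := hneg 1
      rw [transpose_one, det_one, one_mul, mul_one, one_mul, eq_neg_iff_add_eq_zero, ← two_smul ℂ]
        at hone
      exact (smul_eq_zero_iff_right two_ne_zero).mp hone
    rw [hneg g, hzero, mul_zero, neg_zero]

end Pfaffian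

section Deformation

open Matrix

theorem one_add_mul_pow_of_mul_self_eq_zero {S : Type*} [CommRing S] {t : S} (ht : t * t = 0)
    (c : S) (k : ℕ) : (1 + c * t) ^ k = 1 + k * c * t := by
  induction k with
  | zero => rw [pow_zero, Nat.cast_zero, zero_mul, zero_mul, add_zero]
  | succ k ih =>
    rw [pow_succ, ih]
    push_cast
    linear_combination (k * c ^ 2) * ht

variable {ι S : Type*} [CommRing S]

/-- The ideal generated by the entries of a matrix. -/
def entryIdeal (Y : Matrix ι ι S) : Ideal S :=
  Ideal.span (Set.range fun s : ι × ι => Y s.1 s.2)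

theorem entry_mem_entryIdeal (Y : Matrix ι ι S) (i j : ι) : Y i j ∈ entryIdeal Y :=
  Ideal.subset_span ⟨(i, j), rfl⟩

theorem mul_eq_zero_of_mem_entryIdeal {Y : Matrix ι ι S} {t y : S} (ht : t • Y = 0)
    (hy : y ∈ entryIdeal Y) : t * y = 0 := by
  have hle : entryIdeal Y ≤ LinearMap.ker (LinearMap.mulLeft S t) :=
    Ideal.span_le.mpr (Set.range_subset_iff.mpr fun s => congrFun₂ ht s.1 s.2)
  exact hle hy

theorem mul_eq_zero_of_mem_entryIdeal_of_mem {Y : Matrix ι ι S}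
    (hY : ∀ i j k l, Y i j * Y k l = 0) {x y : S} (hx : x ∈ entryIdeal Y)
    (hy : y ∈ entryIdeal Y) : x * y = 0 := by
  refine mul_eq_zero_of_mem_entryIdeal (Matrix.ext fun k l => ?_) hy
  rw [Matrix.smul_apply, smul_eq_mul, mul_comm]
  exact mul_eq_zero_of_mem_entryIdeal (Matrix.ext fun i j => hY k l i j) hx

theorem map_mk_add_entryIdeal (M Y : Matrix ι ι S) :
    (M + Y).map (Ideal.Quotient.mk (entryIdeal Y)) = M.map (Ideal.Quotient.mk (entryIdeal Y)) := by
  ext i j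
  rw [map_apply, map_apply, Ideal.Quotient.eq, Matrix.add_apply, add_sub_cancel_left]
  exact entry_mem_entryIdeal Y i j

variable [Fintype ι]

theorem mul_self_eq_zero_of_entries {Y : Matrix ι ι S} (hY : ∀ i j k l, Y i j * Y k l = 0) :
    Y * Y = 0 :=
  Matrix.ext fun _ _ => Finset.sum_eq_zero fun _ _ => hY _ _ _ _

/-- An infinitesimal deformation `M + Y` of a skew-symmetric matrix `M` which conjugation by `1 + Z`
rescales by `1 - 2 * t`. -/
structure IsRescalingDeformation (M Y Z : Matrix ι ι S) (t : S) : Prop where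
  ZM : Z * M = M * Z
  YM : Y * M = M * Y
  ZY : Z * Y = -(t • M)
  ZZ : ∀ i j k l, Z i j * Z k l = 0
  YY : ∀ i j k l, Y i j * Y k l = 0
  tY : t • Y = 0
  tZ : t • Z = 0
  tt : t * t = 0
  transpose_M : Mᵀ = -M
  transpose_Y : Yᵀ = -Y
  transpose_Z : Zᵀ = -Z

namespace IsRescalingDeformation

variable {M Y Z : Matrix ι ι S} {t : S}

theorem YZ (h : IsRescalingDeformation M Y Z t) : Y * Z = t • M := by
  have := congrArg transpose h.ZY
  rwa [transpose_mul, h.transpose_Y, h.transpose_Z, neg_mul_neg, transpose_neg, transpose_smul,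
    h.transpose_M, smul_neg, neg_neg] at this

theorem transpose_add (h : IsRescalingDeformation M Y Z t) : (M + Y)ᵀ = -(M + Y) := by
  rw [Matrix.transpose_add, h.transpose_M, h.transpose_Y, neg_add]

end IsRescalingDeformation

variable [DecidableEq ι]

theorem det_add_sub_mem (M Y : Matrix ι ι S) : (M + Y).det - M.det ∈ entryIdeal Y := by
  rw [← Ideal.Quotient.eq, RingHom.map_det, RingHom.mapMatrix_apply, map_mk_add_entryIdeal,
    RingHom.map_det, RingHom.mapMatrix_apply]

theorem charpoly_coeff_add_sub_mem (M Y : Matrix ι ι S) (k : ℕ) :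
    (M + Y).charpoly.coeff k - M.charpoly.coeff k ∈ entryIdeal Y := by
  rw [← Ideal.Quotient.eq, ← Polynomial.coeff_map, ← Polynomial.coeff_map, ← charpoly_map,
    ← charpoly_map, map_mk_add_entryIdeal]

theorem trace_pow_add_sub_mem (M Y : Matrix ι ι S) (k : ℕ) :
    ((M + Y) ^ k).trace - (M ^ k).trace ∈ entryIdeal Y := by
  rw [← Ideal.Quotient.eq, AddMonoidHom.map_trace, AddMonoidHom.map_trace, Matrix.map_pow,
    Matrix.map_pow, map_mk_add_entryIdeal]

theorem pfaffian_add_sub_mem [Algebra ℂ S] (M Y : Matrix ι ι S) :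
    pfaffian (M + Y) - pfaffian M ∈ entryIdeal Y := by
  rw [← Ideal.Quotient.eq, ← Ideal.Quotient.mkₐ_eq_mk ℂ, map_pfaffian, map_pfaffian]
  exact congrArg pfaffian (map_mk_add_entryIdeal M Y)

theorem pow_card_eq_neg_sum_charpoly_coeff_smul (M : Matrix ι ι S) :
    M ^ Fintype.card ι = -∑ k ∈ Finset.range (Fintype.card ι), M.charpoly.coeff k • M ^ k := by
  nontriviality S
  have hCH := aeval_self_charpoly M
  rw [M.charpoly_monic.as_sum, charpoly_natDegree_eq_dim] at hCH
  simp only [map_add, map_sum, map_mul, map_pow, Polynomial.aeval_X, Polynomial.aeval_C,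
    ← Algebra.smul_def] at hCH
  exact eq_neg_of_add_eq_zero_left hCH

theorem charpoly_coeff_zero_eq_zero_of_det {M : Matrix ι ι S} (hM : M.det = 0) :
    M.charpoly.coeff 0 = 0 := by
  rw [Polynomial.coeff_zero_eq_eval_zero, eval_charpoly, map_zero, zero_sub, det_neg, hM, mul_zero]

theorem pow_mul_charpoly_smul_coeff (u : S) (X : Matrix ι ι S) (k : ℕ) :
    u ^ k * (u • X).charpoly.coeff k = u ^ Fintype.card ι * X.charpoly.coeff k := by
  have hcharmatrix : (charmatrix (u • X)).map (Polynomial.compRingHom (.C u * .X))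
      = Polynomial.C u • charmatrix X := by
    ext1 i j
    obtain rfl | hij := eq_or_ne i j
    · simp [charmatrix_apply_eq, mul_sub]
    · simp [charmatrix_apply_ne _ _ _ hij]
  have hcomp : (u • X).charpoly.comp (.C u * .X) = .C (u ^ Fintype.card ι) * X.charpoly := by
    rw [Matrix.charpoly, Matrix.charpoly, ← Polynomial.coe_compRingHom_apply, RingHom.map_det,
      RingHom.mapMatrix_apply, hcharmatrix, det_smul, Polynomial.C_pow]
  have hcoeff := congrArg (Polynomial.coeff · k) hcomp
  simp only [Polynomial.comp_C_mul_X_coeff, Polynomial.coeff_C_mul] at hcoeff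
  rw [← hcoeff, mul_comm]

namespace IsRescalingDeformation

variable {M Y Z : Matrix ι ι S} {t : S}

theorem conj_add (h : IsRescalingDeformation M Y Z t) :
    (1 + Z) * (M + Y) * (1 - Z) = (1 + -2 * t) • (M + Y) := by
  have hZMZ : Z * M * Z = 0 := by
    rw [h.ZM, mul_assoc, mul_self_eq_zero_of_entries h.ZZ, mul_zero]
  have hZYZ : Z * Y * Z = 0 := by
    rw [h.ZY, neg_mul, smul_mul_assoc, ← h.ZM, ← smul_mul_assoc, h.tZ, zero_mul, neg_zero]
  calc (1 + Z) * (M + Y) * (1 - Z)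
      = M + Y + (Z * M - M * Z) + Z * Y - Y * Z - Z * M * Z - Z * Y * Z := by noncomm_ring
    _ = M + Y - (2 : S) • (t • M) - (2 : S) • (t • Y) := by
        rw [hZMZ, hZYZ, h.ZM, h.ZY, h.YZ, h.tY, two_smul, smul_zero]
        abel
    _ = (1 + -2 * t) • (M + Y) := by
        rw [neg_mul, ← sub_eq_add_neg, sub_smul, one_smul, mul_smul, smul_add, smul_add]
        abel

theorem one_add_mul_one_sub (h : IsRescalingDeformation M Y Z t) : (1 + Z) * (1 - Z) = 1 := by
  rw [mul_sub, mul_one, add_mul, one_mul, mul_self_eq_zero_of_entries h.ZZ, add_zero,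
    add_sub_cancel_right]

theorem charpoly_smul_add (h : IsRescalingDeformation M Y Z t) :
    ((1 + -2 * t) • (M + Y)).charpoly = (M + Y).charpoly := by
  let u : (Matrix ι ι S)ˣ :=
    ⟨1 + Z, 1 - Z, h.one_add_mul_one_sub, mul_eq_one_comm.mp h.one_add_mul_one_sub⟩
  rw [← h.conj_add, ← inv_eq_right_inv h.one_add_mul_one_sub]
  exact charpoly_units_conj u (M + Y)

theorem add_pow [Algebra ℂ S] (h : IsRescalingDeformation M Y Z t) (k : ℕ) :
    (M + Y) ^ (k + 1) = M ^ (k + 1) + (k + 1 : ℂ) • (Y * M ^ k) := by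
  have hc : Commute Y M := h.YM
  induction k with
  | zero => rw [zero_add, pow_one, pow_one, pow_zero, mul_one, Nat.cast_zero, zero_add, one_smul]
  | succ k ih =>
    have hYYM : Y * M ^ k * Y = 0 := by
      rw [mul_assoc, ← (hc.pow_right k).eq, ← mul_assoc, mul_self_eq_zero_of_entries h.YY, zero_mul]
    rw [pow_succ, ih, add_mul, mul_add, mul_add, smul_mul_assoc, smul_mul_assoc, hYYM, smul_zero,
      add_zero, mul_assoc Y, ← pow_succ, ← pow_succ, ← (hc.pow_right (k + 1)).eq, add_assoc,
      Nat.cast_succ, add_smul (k + 1 : ℂ) 1, one_smul, add_comm (Y * M ^ (k + 1))]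

variable [Algebra ℂ S]

/-- Comparing the characteristic polynomials of the conjugate matrices `M + Y` and
`(1 - 2 * t) • (M + Y)` gives `2 * (card ι - k) * t * c = 0` for their `k`-th coefficient `c`. -/
theorem mul_charpoly_coeff (h : IsRescalingDeformation M Y Z t) {k : ℕ}
    (hk : k < Fintype.card ι) : t * M.charpoly.coeff k = 0 := by
  have hrescale := pow_mul_charpoly_smul_coeff (1 + -2 * t) (M + Y) k
  rw [h.charpoly_smul_add, one_add_mul_pow_of_mul_self_eq_zero h.tt,
    one_add_mul_pow_of_mul_self_eq_zero h.tt] at hrescale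
  have hsmul : (2 * (Fintype.card ι - k) : ℂ) • (t * (M + Y).charpoly.coeff k) = 0 := by
    rw [Algebra.smul_def]
    simp only [map_mul, map_sub, map_natCast, map_ofNat]
    linear_combination hrescale
  have hcoef : (2 * (Fintype.card ι - k) : ℂ) ≠ 0 :=
    mul_ne_zero two_ne_zero (sub_ne_zero.mpr (by exact_mod_cast hk.ne'))
  have hdiff := mul_eq_zero_of_mem_entryIdeal h.tY (charpoly_coeff_add_sub_mem M Y k)
  rwa [mul_sub, (smul_eq_zero.mp hsmul).resolve_left hcoef, zero_sub, neg_eq_zero] at hdiff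

theorem det_one_add (h : IsRescalingDeformation M Y Z t) : (1 + Z).det = 1 := by
  have hsub : (1 - Z).det = (1 + Z).det := by
    rw [← det_transpose, transpose_sub, h.transpose_Z, transpose_one, sub_neg_eq_add]
  have hsq := congrArg det h.one_add_mul_one_sub
  rw [det_mul, hsub, det_one] at hsq
  have hmem : (1 + Z).det - 1 ∈ entryIdeal Z := det_one (n := ι) (R := S) ▸ det_add_sub_mem 1 Z
  have htwo : (2 : ℂ) • ((1 + Z).det - 1) = 0 := by
    rw [Algebra.smul_def, map_ofNat]
    linear_combination hsq - mul_eq_zero_of_mem_entryIdeal_of_mem h.ZZ hmem hmem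
  exact sub_eq_zero.mp ((smul_eq_zero.mp htwo).resolve_left two_ne_zero)

/-- Congruence by `(1 + t) • (1 + Z)` fixes `M + Y` and has determinant `1 + card ι * t`. -/
theorem mul_pfaffian [Nonempty ι] (h : IsRescalingDeformation M Y Z t) : t * pfaffian M = 0 := by
  have hfix : ((1 + t) • (1 + Z)) * (M + Y) * ((1 + t) • (1 + Z))ᵀ = M + Y := by
    have hscalar : (1 + t) * (1 + t) * (1 + -2 * t) = 1 := by
      linear_combination (-3 - 2 * t) * h.tt
    rw [transpose_smul, Matrix.transpose_add, h.transpose_Z, transpose_one, ← sub_eq_add_neg,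
      smul_mul_assoc, smul_mul_assoc, mul_smul_comm, h.conj_add, smul_smul, smul_smul, hscalar,
      one_smul]
  have hdet : ((1 + t) • (1 + Z)).det = 1 + Fintype.card ι * t := by
    simpa only [det_smul, h.det_one_add, one_mul, mul_one] using
      one_add_mul_pow_of_mul_self_eq_zero h.tt 1 (Fintype.card ι)
  have hpf := pfaffian_conj ((1 + t) • (1 + Z)) h.transpose_add
  rw [hfix, hdet] at hpf
  have hsmul : (Fintype.card ι : ℂ) • (t * pfaffian (M + Y)) = 0 := by
    rw [Algebra.smul_def, map_natCast]
    linear_combination -hpf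
  have hcard : (Fintype.card ι : ℂ) ≠ 0 := Nat.cast_ne_zero.mpr Fintype.card_ne_zero
  have hdiff := mul_eq_zero_of_mem_entryIdeal h.tY (pfaffian_add_sub_mem M Y)
  rwa [mul_sub, (smul_eq_zero.mp hsmul).resolve_left hcard, zero_sub, neg_eq_zero] at hdiff

theorem det_add_eq_zero (h : IsRescalingDeformation M Y Z t) (hpf : pfaffian M = 0) :
    (M + Y).det = 0 := by
  have hmem := pfaffian_add_sub_mem M Y
  rw [hpf, sub_zero] at hmem
  rw [← pfaffian_mul_self h.transpose_add]
  exact mul_eq_zero_of_mem_entryIdeal_of_mem h.YY hmem hmem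

/-- In the Cayley-Hamilton identity for `M + Y`, each lower term has trace zero: its coefficient and
the trace of the power of `M + Y` both lie in the square-zero ideal `entryIdeal Y`. -/
theorem trace_add_pow_card_eq_zero (h : IsRescalingDeformation M Y Z t)
    (hchar : ∀ k < Fintype.card ι, M.charpoly.coeff k = 0) (hpf : pfaffian M = 0)
    (htr : ∀ k, (M ^ (k + 1)).trace = 0) : ((M + Y) ^ Fintype.card ι).trace = 0 := by
  rw [pow_card_eq_neg_sum_charpoly_coeff_smul, trace_neg, trace_sum, neg_eq_zero]
  refine Finset.sum_eq_zero fun k hk => ?_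
  rw [trace_smul, smul_eq_mul]
  cases k with
  | zero => rw [charpoly_coeff_zero_eq_zero_of_det (h.det_add_eq_zero hpf), zero_mul]
  | succ k =>
    have hcoeff := charpoly_coeff_add_sub_mem M Y (k + 1)
    have htrace := trace_pow_add_sub_mem M Y (k + 1)
    rw [hchar _ (Finset.mem_range.mp hk), sub_zero] at hcoeff
    rw [htr, sub_zero] at htrace
    exact mul_eq_zero_of_mem_entryIdeal_of_mem h.YY hcoeff htrace

theorem trace_mul_pow_eq_zero [Nonempty ι] (h : IsRescalingDeformation M Y Z t)
    (hchar : ∀ k < Fintype.card ι, M.charpoly.coeff k = 0) (hpf : pfaffian M = 0)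
    (htr : ∀ k, (M ^ (k + 1)).trace = 0) : (Y * M ^ (Fintype.card ι - 1)).trace = 0 := by
  obtain ⟨m, hm⟩ := Nat.exists_eq_succ_of_ne_zero (Fintype.card_ne_zero (α := ι))
  have htrace := h.trace_add_pow_card_eq_zero hchar hpf htr
  rw [hm, h.add_pow, Matrix.trace_add, htr, zero_add, trace_smul] at htrace
  rw [hm, Nat.succ_sub_one]
  exact (smul_eq_zero.mp htrace).resolve_left (Nat.cast_add_one_ne_zero m)

end IsRescalingDeformation

end Deformation

section EvenPart

open ExteriorAlgebra

theorem ι_mul_ι_mul_ι_mul_ι_comm {R M : Type*} [CommRing R] [AddCommGroup M] [Module R M]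
    (x y z w : M) : ι R x * ι R y * (ι R z * ι R w) = ι R z * ι R w * (ι R x * ι R y) := by
  have hcomm (v : M) : Commute (ι R x * ι R y) (ι R v) := by
    rw [commute_iff_eq, mul_assoc, ι_mul_ι_comm y v, mul_neg, ← mul_assoc, ι_mul_ι_comm x v,
      neg_mul, neg_neg, mul_assoc]
  exact (hcomm z).mul_right (hcomm w)

variable (W : Type*) [AddCommGroup W] [Module ℂ W]

/-- The even part of an exterior algebra, generated by the products of two vectors. -/
abbrev evenPart : Subalgebra ℂ (ExteriorAlgebra ℂ W) :=
  Algebra.adjoin ℂ {z | ∃ x y : W, z = ι ℂ x * ι ℂ y}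

instance : CommRing (evenPart W) :=
  { (evenPart W).toRing with
    mul_comm := (Algebra.isMulCommutative_adjoin ℂ (by
      rintro _ ⟨x, y, rfl⟩ _ ⟨z, w, rfl⟩
      exact ι_mul_ι_mul_ι_mul_ι_comm x y z w)).is_comm.comm }

variable {W}

/-- The product of two vectors, as an element of the even part. -/
def evenMul (x y : W) : evenPart W :=
  ⟨ι ℂ x * ι ℂ y, Algebra.subset_adjoin ⟨x, y, rfl⟩⟩

theorem evenMul_swap (x y : W) : evenMul y x = -evenMul x y :=
  Subtype.ext (ι_mul_ι_comm y x)

theorem evenMul_mul_evenMul_left (x y z : W) : evenMul x y * evenMul x z = 0 := by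
  refine Subtype.ext ?_
  change ι ℂ x * ι ℂ y * (ι ℂ x * ι ℂ z) = 0
  rw [ι_mul_ι_comm x y, neg_mul, mul_assoc, ← mul_assoc (ι ℂ x), ι_sq_zero, zero_mul, mul_zero,
    neg_zero]

variable {U : Type*} [AddCommGroup U] [Module ℂ U]

/-- The homomorphism of even parts induced by a linear map. -/
def evenMap (f : U →ₗ[ℂ] W) : evenPart U →ₐ[ℂ] evenPart W :=
  ((ExteriorAlgebra.map f).comp (evenPart U).val).codRestrict (evenPart W) fun z => by
    have hle : evenPart U ≤ (evenPart W).comap (ExteriorAlgebra.map f) := by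
      refine Algebra.adjoin_le ?_
      rintro _ ⟨x, y, rfl⟩
      exact Algebra.subset_adjoin ⟨f x, f y, (map_mul (ExteriorAlgebra.map f) _ _).trans
        (congrArg₂ _ (map_apply_ι f x) (map_apply_ι f y))⟩
    exact hle z.2

theorem evenMap_evenMul (f : U →ₗ[ℂ] W) (x y : U) :
    evenMap f (evenMul x y) = evenMul (f x) (f y) := by
  refine Subtype.ext ?_
  change ExteriorAlgebra.map f (ι ℂ x * ι ℂ y) = ι ℂ (f x) * ι ℂ (f y)
  rw [map_mul, map_apply_ι, map_apply_ι]

end EvenPart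

section Contraction

open ExteriorAlgebra
open CliffordAlgebra (contractLeft contractLeft_ι_mul contractLeft_algebraMap)

variable {R M N : Type*} [CommRing R] [AddCommGroup M] [Module R M] [AddCommGroup N] [Module R N]

theorem eq_zero_of_ι_mul_eq_zero {φ : Module.Dual R N} {w : N} {z : ExteriorAlgebra R N}
    (hw : φ w = 1) (hφ : contractLeft (Q := (0 : QuadraticForm R N)) φ z = 0)
    (hz : ExteriorAlgebra.ι R w * z = 0) : z = 0 := by
  have h := contractLeft_ι_mul (Q := (0 : QuadraticForm R N)) (d := φ) w z
  rw [hφ, mul_zero, sub_zero, hw, one_smul] at h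
  rw [← h, hz, map_zero]

theorem contractLeft_map_eq_zero {f : M →ₗ[R] N} {φ : Module.Dual R N} (h : φ ∘ₗ f = 0)
    (z : ExteriorAlgebra R M) :
    contractLeft (Q := (0 : QuadraticForm R N)) φ (ExteriorAlgebra.map f z) = 0 := by
  induction z using CliffordAlgebra.left_induction with
  | algebraMap r =>
    rw [AlgHom.commutes]
    exact contractLeft_algebraMap (Q := (0 : QuadraticForm R N)) _ _
  | add x y hx hy => rw [map_add, map_add, hx, hy, add_zero]
  | ι_mul x m hx =>
    have hι : ExteriorAlgebra.map f (CliffordAlgebra.ι 0 m) = ExteriorAlgebra.ι R (f m) :=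
      map_apply_ι f m
    have hm : φ (f m) = 0 := LinearMap.congr_fun h m
    rw [map_mul, hι, contractLeft_ι_mul, hx, hm, zero_smul, mul_zero, sub_zero]

theorem eq_zero_of_ι_mul_map_eq_zero {f : M →ₗ[R] N} (hf : Function.Injective (map f))
    {φ : Module.Dual R N} (h : φ ∘ₗ f = 0) {w : N} (hw : φ w = 1) {z : ExteriorAlgebra R M}
    (hz : ExteriorAlgebra.ι R w * ExteriorAlgebra.map f z = 0) : z = 0 :=
  hf <| by rw [eq_zero_of_ι_mul_eq_zero hw (contractLeft_map_eq_zero h z) hz, map_zero]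

theorem eq_zero_of_ι_mul_ι_mul_map_eq_zero {f : M →ₗ[R] N} (hf : Function.Injective (map f))
    {φ ψ : Module.Dual R N} (hφ : φ ∘ₗ f = 0) (hψ : ψ ∘ₗ f = 0) {w w' : N} (hw : φ w = 1)
    (hw₀ : φ w' = 0) (hw' : ψ w' = 1) {z : ExteriorAlgebra R M}
    (hz : ExteriorAlgebra.ι R w * ExteriorAlgebra.ι R w' * ExteriorAlgebra.map f z = 0) :
    z = 0 := by
  refine eq_zero_of_ι_mul_map_eq_zero hf hψ hw' (eq_zero_of_ι_mul_eq_zero hw ?_ ?_)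
  · have h := contractLeft_ι_mul (Q := (0 : QuadraticForm R N)) (d := φ) w' (map f z)
    rwa [contractLeft_map_eq_zero hφ, mul_zero, sub_zero, hw₀, zero_smul] at h
  · rwa [← mul_assoc]

end Contraction

section Vanishing

open Matrix

variable {ι U W : Type*} [AddCommGroup U] [Module ℂ U] [AddCommGroup W] [Module ℂ W]

instance : IsAddTorsionFree (ExteriorAlgebra ℂ U) := .of_isTorsionFree ℂ _

theorem oddMatrix_map (f : U →ₗ[ℂ] W) (w : Matrix ι ι U) :
    oddMatrix (w.map f) = (oddMatrix w).map (ExteriorAlgebra.map f) :=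
  Matrix.ext fun _ _ => (ExteriorAlgebra.map_apply_ι _ _).symm

theorem transpose_map_linearMap (f : U →ₗ[ℂ] W) {w : Matrix ι ι U} (hw : wᵀ = -w) :
    (w.map f)ᵀ = -w.map f := by
  rw [← transpose_map, hw, Matrix.map_neg _ (map_neg f)]

theorem evenPart_map_injective :
    Function.Injective fun X : Matrix ι ι (evenPart U) => X.map (evenPart U).val :=
  Matrix.map_injective Subtype.val_injective

/-- The product of a vector and a matrix of vectors, over the even part. -/
def evenScale (x : U) (w : Matrix ι ι U) : Matrix ι ι (evenPart U) :=
  of fun i j => evenMul x (w i j)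

theorem map_val_evenScale (x : U) (w : Matrix ι ι U) :
    (evenScale x w).map (evenPart U).val = ExteriorAlgebra.ι ℂ x • oddMatrix w :=
  rfl

theorem transpose_evenScale (x : U) {w : Matrix ι ι U} (hw : wᵀ = -w) :
    (evenScale x w)ᵀ = -evenScale x w := by
  refine evenPart_map_injective ?_
  change ((evenScale x w).map (evenPart U).val)ᵀ = (-evenScale x w).map (evenPart U).val
  rw [Matrix.map_neg _ (map_neg _), map_val_evenScale, transpose_smul, transpose_oddMatrix hw,
    smul_neg]

variable [Fintype ι]

/-- The square of a matrix of vectors, over the even part. -/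
def evenSquare (w : Matrix ι ι U) : Matrix ι ι (evenPart U) :=
  of fun i j => ∑ k, evenMul (w i k) (w k j)

theorem map_val_evenSquare (w : Matrix ι ι U) :
    (evenSquare w).map (evenPart U).val = oddMatrix w * oddMatrix w := by
  ext i j
  rw [map_apply, evenSquare, of_apply, map_sum, mul_apply]
  rfl

theorem evenSquare_map (f : U →ₗ[ℂ] W) (w : Matrix ι ι U) :
    evenSquare (w.map f) = (evenSquare w).map (evenMap f) := by
  ext1 i j
  simp only [evenSquare, map_apply, of_apply, map_sum, evenMap_evenMul]

theorem transpose_evenSquare {w : Matrix ι ι U} (hw : wᵀ = -w) :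
    (evenSquare w)ᵀ = -evenSquare w := by
  refine evenPart_map_injective ?_
  change ((evenSquare w).map (evenPart U).val)ᵀ = (-evenSquare w).map (evenPart U).val
  rw [Matrix.map_neg _ (map_neg _), map_val_evenSquare,
    (entrywiseCommute_oddMatrix w w).transpose_mul, transpose_oddMatrix hw, neg_mul_neg,
    neg_one_zsmul]

theorem oddMatrix_mul_ι_smul (w : Matrix ι ι U) (x : U) (X : Matrix ι ι (ExteriorAlgebra ℂ U)) :
    oddMatrix w * ExteriorAlgebra.ι ℂ x • X = -(ExteriorAlgebra.ι ℂ x • (oddMatrix w * X)) := by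
  ext i j
  simp only [mul_apply, Matrix.neg_apply, Matrix.smul_apply, smul_eq_mul, Finset.mul_sum,
    ← Finset.sum_neg_distrib, ← mul_assoc]
  exact Finset.sum_congr rfl fun k _ => by
    rw [← neg_mul]
    exact congrArg (· * X k j) (ι_mul_ι_comm (w i k) x)

theorem evenScale_mul_evenSquare (x : U) (w : Matrix ι ι U) :
    evenScale x w * evenSquare w = evenSquare w * evenScale x w := by
  refine evenPart_map_injective ?_
  simp only [Matrix.map_mul, map_val_evenSquare, map_val_evenScale, Matrix.mul_assoc,
    Matrix.smul_mul, oddMatrix_mul_ι_smul, Matrix.mul_neg, neg_neg]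

theorem evenScale_mul_evenScale (x y : U) (w : Matrix ι ι U) :
    evenScale x w * evenScale y w = -(evenMul x y • evenSquare w) := by
  refine evenPart_map_injective ?_
  have hsmul : (evenMul x y • evenSquare w).map (evenPart U).val
      = ExteriorAlgebra.ι ℂ x • ExteriorAlgebra.ι ℂ y • (oddMatrix w * oddMatrix w) := by
    rw [← map_val_evenSquare, smul_smul]
    rfl
  change (evenScale x w * evenScale y w).map (evenPart U).val
    = (-(evenMul x y • evenSquare w)).map (evenPart U).val
  rw [Matrix.map_neg _ (map_neg _), hsmul, Matrix.map_mul, map_val_evenScale, map_val_evenScale,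
    Matrix.smul_mul, oddMatrix_mul_ι_smul, smul_neg]

theorem isRescalingDeformation_evenSquare {w : Matrix ι ι U} (hw : wᵀ = -w) (x y : U) :
    IsRescalingDeformation (evenSquare w) (evenScale y w) (evenScale x w) (evenMul x y) where
  ZM := evenScale_mul_evenSquare x w
  YM := evenScale_mul_evenSquare y w
  ZY := evenScale_mul_evenScale x y w
  ZZ _ _ _ _ := evenMul_mul_evenMul_left x _ _
  YY _ _ _ _ := evenMul_mul_evenMul_left y _ _
  tY := Matrix.ext fun i j => by
    change evenMul x y * evenMul y (w i j) = 0
    rw [evenMul_swap y x, neg_mul, evenMul_mul_evenMul_left, neg_zero]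
  tZ := Matrix.ext fun _ _ => evenMul_mul_evenMul_left x y _
  tt := evenMul_mul_evenMul_left x y y
  transpose_M := transpose_evenSquare hw
  transpose_Y := transpose_evenScale y hw
  transpose_Z := transpose_evenScale x hw

theorem exteriorAlgebra_map_inl_injective (U : Type*) [AddCommGroup U] [Module ℂ U] :
    Function.Injective (ExteriorAlgebra.map (LinearMap.inl ℂ U (ℂ × ℂ))) :=
  ExteriorAlgebra.map_injective ⟨LinearMap.fst ℂ U (ℂ × ℂ), LinearMap.fst_comp_inl ℂ U _⟩

theorem eq_zero_of_evenMul_mul_evenMap_inl_eq_zero {z : evenPart U}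
    (hz : evenMul ((0, 1, 0) : U × ℂ × ℂ) (0, 0, 1) * evenMap (LinearMap.inl ℂ U (ℂ × ℂ)) z = 0) :
    z = 0 :=
  Subtype.ext <| eq_zero_of_ι_mul_ι_mul_map_eq_zero (exteriorAlgebra_map_inl_injective U)
    (φ := LinearMap.fst ℂ ℂ ℂ ∘ₗ LinearMap.snd ℂ U (ℂ × ℂ))
    (ψ := LinearMap.snd ℂ ℂ ℂ ∘ₗ LinearMap.snd ℂ U (ℂ × ℂ)) rfl rfl rfl rfl rfl
    (congrArg Subtype.val hz)

variable [DecidableEq ι]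

theorem map_val_pow (X : Matrix ι ι (evenPart U)) (k : ℕ) :
    (X ^ k).map (evenPart U).val = X.map (evenPart U).val ^ k :=
  map_pow (evenPart U).val.mapMatrix X k

theorem val_trace_pow_evenSquare (w : Matrix ι ι U) (k : ℕ) :
    (evenPart U).val (evenSquare w ^ k).trace = (oddMatrix w ^ (2 * k)).trace := by
  rw [AddMonoidHom.map_trace, map_val_pow, map_val_evenSquare, ← pow_two, pow_mul]

variable {w : Matrix ι ι U} (hw : wᵀ = -w)

include hw

theorem charpoly_evenSquare_coeff {k : ℕ} (hk : k < Fintype.card ι) :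
    (evenSquare w).charpoly.coeff k = 0 := by
  have h := (isRescalingDeformation_evenSquare
    (transpose_map_linearMap (LinearMap.inl ℂ U (ℂ × ℂ)) hw) (0, 1, 0)
    (0, 0, 1)).mul_charpoly_coeff hk
  refine eq_zero_of_evenMul_mul_evenMap_inl_eq_zero ?_
  rwa [evenSquare_map, ← AlgHom.coe_toRingHom, charpoly_map, Polynomial.coeff_map] at h

theorem pfaffian_evenSquare [Nonempty ι] : pfaffian (evenSquare w) = 0 := by
  have h := (isRescalingDeformation_evenSquare
    (transpose_map_linearMap (LinearMap.inl ℂ U (ℂ × ℂ)) hw) (0, 1, 0) (0, 0, 1)).mul_pfaffian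
  refine eq_zero_of_evenMul_mul_evenMap_inl_eq_zero ?_
  rwa [evenSquare_map, ← map_pfaffian] at h

/-- An analogue of the Amitsur–Levitzki theorem. -/
theorem oddMatrix_pow_eq_zero : oddMatrix w ^ (2 * Fintype.card ι) = 0 := by
  have hpow : evenSquare w ^ Fintype.card ι = 0 := by
    rw [pow_card_eq_neg_sum_charpoly_coeff_smul, neg_eq_zero]
    refine Finset.sum_eq_zero fun k hk => ?_
    rw [charpoly_evenSquare_coeff hw (Finset.mem_range.mp hk), zero_smul]
  rw [pow_mul, pow_two, ← map_val_evenSquare, ← map_val_pow, hpow, Matrix.map_zero _ (map_zero _)]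

theorem trace_evenScale_mul_pow_evenSquare [Nonempty ι] (x y : U) :
    (evenScale y w * evenSquare w ^ (Fintype.card ι - 1)).trace = 0 := by
  refine (isRescalingDeformation_evenSquare hw x y).trace_mul_pow_eq_zero
    (fun _ => charpoly_evenSquare_coeff hw) (pfaffian_evenSquare hw) fun k => Subtype.ext ?_
  refine (val_trace_pow_evenSquare w _).trans ?_
  exact (entrywiseCommute_oddMatrix w w).trace_pow_succ_eq_zero_of_odd (k := 2 * k + 1) ⟨k, rfl⟩

/-- An analogue of a theorem of Kostant. -/
theorem trace_oddMatrix_pow_eq_zero : (oddMatrix w ^ (2 * Fintype.card ι - 1)).trace = 0 := by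
  cases isEmpty_or_nonempty ι with
  | inl h => exact Finset.sum_of_isEmpty _
  | inr h =>
    let f := LinearMap.inl ℂ U (ℂ × ℂ)
    have hpow : 2 * Fintype.card ι - 1 = 2 * (Fintype.card ι - 1) + 1 := by
      have := Fintype.card_pos (α := ι)
      omega
    have htrace := congrArg (evenPart (U × ℂ × ℂ)).val
      (trace_evenScale_mul_pow_evenSquare (transpose_map_linearMap f hw) 0 (0, 0, 1))
    rw [map_zero, AddMonoidHom.map_trace, Matrix.map_mul, map_val_pow, map_val_evenSquare,
      map_val_evenScale, ← pow_two, ← pow_mul, smul_mul_assoc, ← pow_succ', ← hpow, oddMatrix_map,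
      ← AlgHom.mapMatrix_apply, ← map_pow, AlgHom.mapMatrix_apply, trace_smul,
      ← AddMonoidHom.map_trace] at htrace
    exact eq_zero_of_ι_mul_map_eq_zero (exteriorAlgebra_map_inl_injective U)
      (φ := LinearMap.snd ℂ ℂ ℂ ∘ₗ LinearMap.snd ℂ U (ℂ × ℂ)) rfl rfl htrace

end Vanishing

section Determinants

open Matrix Module

variable {K M ι : Type*} [Field K] [AddCommGroup M] [Module K M]

theorem exteriorPower_map_basis_of_apply_basis [LinearOrder ι] {b : Basis ι K M} {f : M →ₗ[K] M}
    {c : ι → K} (hf : ∀ i, f (b i) = c i • b i) {k : ℕ} (s : Set.powersetCard ι k) :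
    exteriorPower.map k f (b.exteriorPower k s) = (∏ i ∈ s.1, c i) • b.exteriorPower k s := by
  have hprod : ∏ i ∈ s.1, c i = ∏ j, c (Set.powersetCard.ofFinEmbEquiv.symm s j) := by
    rw [← Finset.prod_coe_sort, ← (s.1.orderIsoOfFin s.2).toEquiv.prod_comp]
    rfl
  rw [exteriorPower.basis_apply, exteriorPower.ιMulti_family, exteriorPower.map_apply_ιMulti,
    hprod, ← AlternatingMap.map_smul_univ]
  exact congrArg _ (funext fun j => hf _)

variable [Fintype ι]

theorem monoidHom_ext_of_diagonal [NeZero (2 : K)] [DecidableEq ι] {N : Type*} [CommMonoid N]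
    {φ ψ : Matrix ι ι K →* N} (h : ∀ d, φ (diagonal d) = ψ (diagonal d)) : φ = ψ := by
  have map_transvection : ∀ (χ : Matrix ι ι K →* N) (t : TransvectionStruct ι K),
      χ t.toMatrix = 1 := fun χ t => by
    let D : Matrix ι ι K := diagonal fun k => if k = t.i then 2 else 1
    have hD : IsUnit D := by
      refine isUnit_diagonal.mpr (Pi.isUnit_iff.mpr fun k => ?_)
      split_ifs
      exacts [(NeZero.ne (2 : K)).isUnit, isUnit_one]
    have hsq : D * t.toMatrix = t.toMatrix * t.toMatrix * D := by
      rw [TransvectionStruct.toMatrix, transvection_mul_transvection_same _ _ t.hij]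
      ext p q
      simp only [D, diagonal_mul, mul_diagonal, transvection, Matrix.add_apply, one_apply,
        single_apply]
      grind [t.hij]
    have ht : IsUnit t.toMatrix := (isUnit_iff_isUnit_det _).mpr (by simp)
    have hχ : χ D * χ t.toMatrix * 1 = χ D * χ t.toMatrix * χ t.toMatrix := by
      rw [mul_one, mul_assoc, ← map_mul, ← map_mul, hsq, map_mul, mul_comm]
    exact (((hD.map χ).mul (ht.map χ)).mul_left_cancel hχ).symm
  refine MonoidHom.ext fun A => ?_
  refine diagonal_transvection_induction (fun A => φ A = ψ A) A (fun d _ => h d) (fun t => ?_)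
    fun A B hA hB => by rw [map_mul, map_mul, hA, hB]
  rw [map_transvection, map_transvection]

theorem det_eq_prod_of_apply_basis {b : Basis ι K M} {f : M →ₗ[K] M} {c : ι → K}
    (hf : ∀ i, f (b i) = c i • b i) : LinearMap.det f = ∏ i, c i := by
  classical
  have hdiag : LinearMap.toMatrix b b f = diagonal c := by
    ext i j
    rw [LinearMap.toMatrix_apply, hf, map_smul, Basis.repr_self, diagonal_apply]
    rcases eq_or_ne i j with rfl | hij <;> simp [*, Ne.symm]
  rw [← LinearMap.det_toMatrix b, hdiag, det_diagonal]

theorem prod_powersetCard_succ_prod {N : Type*} [CommMonoid N] (d : ι → N) (k : ℕ) :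
    ∏ s : Set.powersetCard ι (k + 1), ∏ i ∈ s.1, d i
      = (∏ i, d i) ^ (Fintype.card ι - 1).choose k := by
  classical
  have hcard : ∀ i : ι, ((Finset.univ.powersetCard (k + 1)).filter ({i} ⊆ ·)).card
      = (Fintype.card ι - 1).choose k := fun i => by
    rw [Finset.card_filter_powersetCard_subset _ _ _ (by simp) (by simp)]
    simp
  calc ∏ s : Set.powersetCard ι (k + 1), ∏ i ∈ s.1, d i
      = ∏ s ∈ Finset.univ.powersetCard (k + 1), ∏ i ∈ s, d i :=
        (Finset.prod_subtype _ (fun _ => Finset.mem_powersetCard_univ) fun s => ∏ i ∈ s, d i).symm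
    _ = ∏ i, ∏ _s ∈ (Finset.univ.powersetCard (k + 1)).filter ({i} ⊆ ·), d i :=
        Finset.prod_comm' (by simp)
    _ = (∏ i, d i) ^ (Fintype.card ι - 1).choose k := by
        simp_rw [Finset.prod_const, hcard, Finset.prod_pow]

/-- The Sylvester–Franke theorem. -/
theorem det_exteriorPower_map [NeZero (2 : K)] [LinearOrder ι] (b : Basis ι K M) (f : M →ₗ[K] M)
    (k : ℕ) :
    LinearMap.det (exteriorPower.map (k + 1) f)
      = LinearMap.det f ^ (Fintype.card ι - 1).choose k := by
  let φ : Matrix ι ι K →* K :=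
    { toFun G := LinearMap.det (exteriorPower.map (k + 1) (toLin b b G))
      map_one' := by rw [toLin_one, exteriorPower.map_id, LinearMap.det_id]
      map_mul' G H := by rw [toLin_mul b b b, exteriorPower.map_comp, LinearMap.det_comp] }
  have hφ : φ = (powMonoidHom ((Fintype.card ι - 1).choose k)).comp detMonoidHom :=
    monoidHom_ext_of_diagonal fun d => by
      have hd : ∀ i, toLin b b (diagonal d) (b i) = d i • b i := fun i => by
        simp [toLin_self, diagonal_apply]
      change LinearMap.det (exteriorPower.map (k + 1) (toLin b b (diagonal d)))
        = (diagonal d).det ^ (Fintype.card ι - 1).choose k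
      rw [det_eq_prod_of_apply_basis (exteriorPower_map_basis_of_apply_basis hd),
        prod_powersetCard_succ_prod, det_diagonal]
  have hf := DFunLike.congr_fun hφ (LinearMap.toMatrix b b f)
  change LinearMap.det (exteriorPower.map (k + 1) (toLin b b (LinearMap.toMatrix b b f)))
    = (LinearMap.toMatrix b b f).det ^ (Fintype.card ι - 1).choose k at hf
  rwa [toLin_toMatrix, LinearMap.det_toMatrix] at hf

end Determinants

section TopForm

open Matrix Module

theorem alternatingMap_apply_eq_det_smul {R M N ι : Type*} [CommRing R] [AddCommGroup M]
    [Module R M] [AddCommGroup N] [Module R N] [Fintype ι] [DecidableEq ι] (b : Basis ι R M)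
    (A : M [⋀^ι]→ₗ[R] N) (v : ι → M) : A v = b.det v • A b := by
  have h : A = (LinearMap.toSpanSingleton R N (A b)).compAlternatingMap b.det := by
    refine b.ext_alternating fun σ hσ => ?_
    obtain ⟨σ, rfl⟩ : ∃ τ : Equiv.Perm ι, ⇑τ = σ :=
      ⟨Equiv.ofBijective σ (Finite.injective_iff_bijective.mp hσ), rfl⟩
    change A (b ∘ σ) = b.det (b ∘ σ) • A b
    simp [AlternatingMap.map_perm, Basis.det_self]
  exact DFunLike.congr_fun h v

variable {R M I : Type*} [CommRing R] [AddCommGroup M] [Module R M] [Fintype I]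
  [LinearOrder I]

theorem exteriorAlgebra_map_basis_univ (b : Basis I R M) (f : M →ₗ[R] M) :
    ExteriorAlgebra.map f (b.ExteriorAlgebra Finset.univ)
      = LinearMap.det f • b.ExteriorAlgebra Finset.univ := by
  let σ : Fin (Fintype.card I) ≃ I :=
    (Finset.univ.orderIsoOfFin rfl).toEquiv.trans (Equiv.subtypeUnivEquiv Finset.mem_univ)
  have hb : b.ExteriorAlgebra Finset.univ
      = ExteriorAlgebra.ιMulti R (Fintype.card I) (b.reindex σ.symm) := by
    rw [ExteriorAlgebra.basis_apply_ofCard b Finset.card_univ, Basis.coe_reindex]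
    rfl
  rw [hb, ExteriorAlgebra.map_apply_ιMulti, alternatingMap_apply_eq_det_smul (b.reindex σ.symm),
    Basis.det_comp, Basis.det_self, mul_one]

variable {V : Type*} [AddCommGroup V] [Module ℂ V] {n : ℕ}

theorem det_sq_of_mem_orthogonalGroupOf {B : LinearMap.BilinForm ℂ V} {e : Basis (Fin n) ℂ V}
    (he : ∀ i j, B (e i) (e j) = if i = j then 1 else 0) {g : V ≃ₗ[ℂ] V}
    (hg : g ∈ orthogonalGroupOf B) : LinearMap.det (g : V →ₗ[ℂ] V) ^ 2 = 1 := by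
  have h := congrArg det ((mem_orthogonalGroupOf_iff_transpose_mul_toMatrix he g).mp hg)
  rwa [det_mul, det_transpose, LinearMap.det_toMatrix, det_one, ← pow_two] at h

theorem extAlgBasis_univ_mem_traceAlgebra (e : Basis (Fin n) ℂ V) (hn : Odd n) :
    extAlgBasis e Finset.univ ∈ traceAlgebra (matrixA e) := by
  let B : LinearMap.BilinForm ℂ V := Matrix.toBilin e 1
  have he : ∀ i j, B (e i) (e j) = if i = j then 1 else 0 := fun i j => by
    rw [← one_apply, ← LinearMap.BilinForm.toMatrix_apply e, LinearMap.BilinForm.toMatrix_toBilin]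
  rw [traceAlgebra_eq_orthogonalInvariants he]
  intro g hg
  obtain ⟨r, rfl⟩ := hn
  rw [lambdaTwoAction, extAlgBasis, exteriorAlgebra_map_basis_univ, det_exteriorPower_map e,
    Fintype.card_fin, Nat.add_sub_cancel, Nat.choose_one_right, pow_mul,
    det_sq_of_mem_orthogonalGroupOf he hg, one_pow, one_smul]

end TopForm

section Injectivity

open Module

variable {K I M : Type*} [Field K] [LinearOrder I] [AddCommGroup M] [Module K M]

theorem exteriorAlgebra_basis_mul_eq_zero (b : Basis I K M) {s t : Finset I}
    (h : ¬Disjoint s t) : b.ExteriorAlgebra s * b.ExteriorAlgebra t = 0 :=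
  ExteriorAlgebra.basis_mul_of_not_disjoint b (⟨s, rfl⟩ : Set.powersetCard I s.card)
    (⟨t, rfl⟩ : Set.powersetCard I t.card) h

variable [Fintype I]

theorem exists_basis_mul_basis_compl (b : Basis I K M) (s : Finset I) :
    ∃ u : ℤˣ, b.ExteriorAlgebra s * b.ExteriorAlgebra sᶜ = u • b.ExteriorAlgebra Finset.univ := by
  have hd : Disjoint (⟨s, rfl⟩ : Set.powersetCard I s.card).val
      (⟨sᶜ, rfl⟩ : Set.powersetCard I sᶜ.card).val := disjoint_compl_right
  have huniv : (Set.powersetCard.disjUnion hd).1 = Finset.univ := by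
    ext i
    simp [Set.powersetCard.disjUnion]
  exact ⟨_, huniv ▸ ExteriorAlgebra.basis_mul_of_disjoint b _ _ hd⟩

theorem exists_mul_basis_compl_eq_smul (b : Basis I K M) {z : ExteriorAlgebra K M} (hz : z ≠ 0) :
    ∃ s, ∃ c : K, c ≠ 0 ∧
      z * b.ExteriorAlgebra sᶜ = c • (b.ExteriorAlgebra s * b.ExteriorAlgebra sᶜ) := by
  obtain ⟨s, hs, hmin⟩ := (b.ExteriorAlgebra.repr z).support.exists_min_image Finset.card <| by
    rwa [Finsupp.support_nonempty_iff, ne_eq, LinearEquiv.map_eq_zero_iff]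
  refine ⟨s, b.ExteriorAlgebra.repr z s, Finsupp.mem_support_iff.mp hs, ?_⟩
  conv_lhs => rw [← b.ExteriorAlgebra.sum_repr z]
  simp_rw [Finset.sum_mul, smul_mul_assoc]
  refine Finset.sum_eq_single_of_mem s (Finset.mem_univ s) fun t _ hts => ?_
  by_cases ht : b.ExteriorAlgebra.repr z t = 0
  · rw [ht, zero_smul]
  · rw [exteriorAlgebra_basis_mul_eq_zero b fun hd => hts ?_, smul_zero]
    exact Finset.eq_of_subset_of_card_le (disjoint_compl_right_iff.mp hd)
      (hmin t (Finsupp.mem_support_iff.mpr ht))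

variable {R : Type*} [Ring R] [Algebra K R]

theorem injective_of_map_basis_univ_ne_zero (b : Basis I K M) {φ : ExteriorAlgebra K M →ₐ[K] R}
    (hφ : φ (b.ExteriorAlgebra Finset.univ) ≠ 0) : Function.Injective φ := by
  refine (injective_iff_map_eq_zero φ).mpr fun z hz => by_contra fun hz0 => hφ ?_
  obtain ⟨s, c, hc, hmul⟩ := exists_mul_basis_compl_eq_smul b hz0
  obtain ⟨u, hu⟩ := exists_basis_mul_basis_compl b s
  have h := congrArg φ hmul
  rw [map_mul, hz, zero_mul, hu, map_smul, Units.smul_def, map_zsmul, ← Units.smul_def] at h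
  exact (smul_eq_zero_iff_eq u).mp ((smul_eq_zero_iff_right hc).mp h.symm)

end Injectivity

section Graded

open Module

variable {K I M R : Type*} [Field K] [LinearOrder I] [AddCommGroup M] [Module K M]
  [Ring R] [Algebra K R] (𝒜 : ℕ → Submodule K R) [GradedAlgebra 𝒜] {b : Basis I K M}
  {φ : ExteriorAlgebra K M →ₐ[K] R} {d : I → ℕ}

theorem map_basis_mem_graded (hd : ∀ i, φ (ExteriorAlgebra.ι K (b i)) ∈ 𝒜 (d i)) (s : Finset I) :
    φ (b.ExteriorAlgebra s) ∈ 𝒜 (∑ i ∈ s, d i) := by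
  have hsum : ∑ i ∈ s, d i = (List.ofFn fun j => d (s.orderEmbOfFin rfl j)).sum := by
    rw [List.sum_ofFn, ← Finset.sum_coe_sort, ← (s.orderIsoOfFin rfl).toEquiv.sum_comp]
    rfl
  rw [ExteriorAlgebra.basis_apply_ofCard b rfl, ExteriorAlgebra.ιMulti_family,
    ExteriorAlgebra.ιMulti_apply, map_list_prod, List.map_ofFn, hsum]
  exact SetLike.list_prod_ofFn_mem_graded _ _ fun j => hd _

theorem injective_of_mem_graded [Fintype I] (hd₀ : ∀ i, 0 < d i)
    (hd : ∀ i, φ (ExteriorAlgebra.ι K (b i)) ∈ 𝒜 (d i)) {t : R} (ht₀ : t ≠ 0)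
    (ht : t ∈ 𝒜 (∑ i, d i)) (hrange : t ∈ φ.range) : Function.Injective φ := by
  obtain ⟨z, rfl⟩ := hrange
  refine injective_of_map_basis_univ_ne_zero b fun huniv => ht₀ ?_
  have hproj : ∀ s, GradedAlgebra.proj 𝒜 (∑ i, d i) (φ (b.ExteriorAlgebra s)) = 0 := fun s => by
    rcases eq_or_ne s Finset.univ with rfl | hs
    · rw [huniv, map_zero]
    · obtain ⟨i, hi⟩ : ∃ i, i ∉ s := by
        by_contra! h
        exact hs (Finset.eq_univ_of_forall h)
      refine DirectSum.decompose_of_mem_ne 𝒜 (map_basis_mem_graded 𝒜 hd s) (ne_of_lt ?_)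
      exact Finset.sum_lt_sum_of_subset s.subset_univ (Finset.mem_univ i) hi (hd₀ i)
        fun _ _ _ => Nat.zero_le _
  calc φ z = GradedAlgebra.proj 𝒜 (∑ i, d i) (φ z) :=
        (DirectSum.decompose_of_mem_same 𝒜 ht).symm
    _ = 0 := by
        rw [← b.ExteriorAlgebra.sum_repr z]
        simp_rw [map_sum, map_smul, hproj, smul_zero, Finset.sum_const_zero]

end Graded

section Freeness

open Matrix Module

variable {V : Type*} [AddCommGroup V] [Module ℂ V] {n : ℕ}

theorem matrixA_pow_apply_mem (e : Fin n → V) (k : ℕ) (i j : Fin n) :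
    (matrixA e ^ k) i j ∈ ⋀[ℂ]^k (⋀[ℂ]^2 V) := by
  induction k generalizing j with
  | zero =>
    rw [pow_zero, one_apply]
    split_ifs
    · exact SetLike.one_mem_graded (A := fun k : ℕ => ⋀[ℂ]^k (⋀[ℂ]^2 V))
    · exact zero_mem _
  | succ k ih =>
    rw [pow_succ, mul_apply]
    refine sum_mem fun l _ => ?_
    refine SetLike.mul_mem_graded (A := fun k : ℕ => ⋀[ℂ]^k (⋀[ℂ]^2 V)) (ih l) ?_
    exact (pow_one (LinearMap.range (ExteriorAlgebra.ι ℂ (M := ⋀[ℂ]^2 V)))).ge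
      (LinearMap.mem_range_self _ _)

theorem qTrace_mem (e : Fin n → V) (k : ℕ) : qTrace e k ∈ ⋀[ℂ]^k (⋀[ℂ]^2 V) := by
  rw [qTrace, trace]
  exact sum_mem fun i _ => matrixA_pow_apply_mem e k i i

theorem qTrace_eq_zero_of_mod_four_ne_three (e : Fin n → V) {k : ℕ} (hk₀ : k ≠ 0)
    (hk : k % 4 ≠ 3) : qTrace e k = 0 :=
  (entrywiseCommute_matrixA e).trace_pow_eq_zero_of_mod_four_ne_three (transpose_matrixA e) hk₀ hk

theorem qTrace_eq_zero_of_two_mul_le (e : Fin n → V) {k : ℕ} (hk : 2 * n ≤ k + 1) :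
    qTrace e k = 0 := by
  rcases (by omega : 2 * n ≤ k ∨ k = 2 * n - 1) with h | rfl
  · have hpow : matrixA e ^ (2 * n) = 0 := by
      have hodd := oddMatrix_pow_eq_zero (transpose_wedgeMatrix e)
      rwa [Fintype.card_fin] at hodd
    rw [qTrace, pow_eq_zero_of_le h hpow, trace_zero]
  · have htrace := trace_oddMatrix_pow_eq_zero (transpose_wedgeMatrix e)
    rwa [Fintype.card_fin] at htrace

theorem adjoin_qTrace_eq_traceAlgebra (e : Fin n → V) {r : ℕ} (hr : n ≤ 2 * r + 2) :
    Algebra.adjoin ℂ (Set.range fun j : Fin r => qTrace e (4 * (j : ℕ) + 3))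
      = traceAlgebra (matrixA e) := by
  refine le_antisymm (Algebra.adjoin_mono ?_) (Algebra.adjoin_le ?_)
  · rintro _ ⟨j, rfl⟩
    exact ⟨_, rfl⟩
  · rintro _ ⟨k, rfl⟩
    change qTrace e (k + 1) ∈ _
    by_cases hmod : (k + 1) % 4 = 3
    · obtain ⟨j, rfl⟩ : ∃ j, k = 4 * j + 2 := ⟨k / 4, by omega⟩
      by_cases hj : j < r
      · exact Algebra.subset_adjoin ⟨⟨j, hj⟩, rfl⟩
      · rw [qTrace_eq_zero_of_two_mul_le e (by omega)]
        exact zero_mem _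
    · rw [qTrace_eq_zero_of_mod_four_ne_three e k.succ_ne_zero hmod]
      exact zero_mem _

theorem qTrace_mul_qTrace (e : Fin n → V) (i j : ℕ) :
    qTrace e (4 * i + 3) * qTrace e (4 * j + 3) = -(qTrace e (4 * j + 3) * qTrace e (4 * i + 3)) :=
  (entrywiseCommute_matrixA e).trace_pow_mul_trace_pow ⟨2 * i + 1, by ring⟩ ⟨2 * j + 1, by ring⟩

/-- The homomorphism from the exterior algebra on `r` generators that sends the generators to
`q_3, q_7, …, q_{4r-1}`. -/
def qTraceLift (e : Fin n → V) (r : ℕ) : ExteriorAlgebra ℂ (Fin r → ℂ) →ₐ[ℂ] ExtAlgLambdaTwo V :=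
  anticommutingLift (Pi.basisFun ℂ (Fin r)) (x := fun j : Fin r => qTrace e (4 * (j : ℕ) + 3))
    fun _ _ => qTrace_mul_qTrace e _ _

theorem qTraceLift_ι_basisFun (e : Fin n → V) {r : ℕ} (j : Fin r) :
    qTraceLift e r (ExteriorAlgebra.ι ℂ (Pi.basisFun ℂ (Fin r) j)) = qTrace e (4 * (j : ℕ) + 3) :=
  anticommutingLift_ι_basis _ _ j

theorem range_qTraceLift (e : Fin n → V) {r : ℕ} (hr : n ≤ 2 * r + 2) :
    (qTraceLift e r).range = traceAlgebra (matrixA e) :=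
  (range_anticommutingLift _ _).trans (adjoin_qTrace_eq_traceAlgebra e hr)

theorem sum_four_mul_add_three (r : ℕ) :
    ∑ j : Fin r, (4 * (j : ℕ) + 3) = (2 * r + 1).choose 2 := by
  rw [Nat.choose_two_right, Nat.add_sub_cancel]
  refine (Nat.div_eq_of_eq_mul_left two_pos ?_).symm
  induction r with
  | zero => rfl
  | succ r ih =>
    rw [Fin.sum_univ_castSucc]
    simp only [Fin.val_castSucc, Fin.val_last, add_mul, ← ih]
    ring

theorem extAlgBasis_univ_mem (e : Basis (Fin n) ℂ V) :
    extAlgBasis e Finset.univ ∈ ⋀[ℂ]^(n.choose 2) (⋀[ℂ]^2 V) := by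
  rw [extAlgBasis, ExteriorAlgebra.basis_apply_ofCard _ (Finset.card_fin _)]
  exact ExteriorAlgebra.ιMulti_range ℂ _ ⟨_, rfl⟩

theorem qTraceLift_injective_of_odd {r : ℕ} (e : Basis (Fin (2 * r + 1)) ℂ V) :
    Function.Injective (qTraceLift e r) := by
  refine injective_of_mem_graded (fun k : ℕ => ⋀[ℂ]^k (⋀[ℂ]^2 V)) (b := Pi.basisFun ℂ (Fin r))
    (d := fun j => 4 * (j : ℕ) + 3) (fun _ => Nat.succ_pos _) (fun j => ?_)
    ((extAlgBasis e).ne_zero Finset.univ) ?_ ?_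
  · rw [qTraceLift_ι_basisFun]
    exact qTrace_mem _ _
  · rw [sum_four_mul_add_three]
    exact extAlgBasis_univ_mem e
  · rw [range_qTraceLift e (by omega)]
    exact extAlgBasis_univ_mem_traceAlgebra e (odd_two_mul_add_one r)

theorem map_qTrace {M : Type*} [AddCommGroup M] [Module ℂ M] (f : V →ₗ[ℂ] M) (e : Fin n → V)
    (k : ℕ) :
    ExteriorAlgebra.map (exteriorPower.map 2 f) (qTrace e k) = qTrace (f ∘ e) k := by
  rw [qTrace, AddMonoidHom.map_trace, ← AlgHom.mapMatrix_apply, map_pow, AlgHom.mapMatrix_apply,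
    map_matrixA, qTrace]

theorem matrixA_snoc_zero_pow_castSucc (v : Fin n → V) (k : ℕ) (i j : Fin n) :
    (matrixA (Fin.snoc v 0 : Fin (n + 1) → V) ^ k) i.castSucc j.castSucc = (matrixA v ^ k) i j := by
  induction k generalizing j with
  | zero => simp [one_apply]
  | succ k ih =>
    rw [pow_succ, pow_succ, mul_apply, mul_apply, Fin.sum_univ_castSucc]
    simp only [ih, matrixA_apply, Fin.snoc_castSucc, Fin.snoc_last]
    rw [(exteriorPower.ιMulti ℂ 2).map_coord_zero (m := ![0, v j]) 0 rfl, map_zero, mul_zero,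
      add_zero]

theorem qTrace_snoc_zero (v : Fin n → V) (k : ℕ) :
    qTrace (Fin.snoc v 0 : Fin (n + 1) → V) (k + 1) = qTrace v (k + 1) := by
  have hlast : (matrixA (Fin.snoc v 0 : Fin (n + 1) → V) ^ (k + 1)) (Fin.last n) (Fin.last n)
      = 0 := by
    rw [pow_succ, mul_apply]
    refine Finset.sum_eq_zero fun l _ => ?_
    rw [matrixA_apply, (exteriorPower.ιMulti ℂ 2).map_coord_zero 1 (by simp), map_zero,
      mul_zero]
  rw [qTrace, qTrace, trace, trace, Fin.sum_univ_castSucc]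
  simp only [diag_apply, matrixA_snoc_zero_pow_castSucc, hlast, add_zero]

theorem qTraceLift_injective_of_even {r : ℕ} (e : Basis (Fin (2 * r + 2)) ℂ V) :
    Function.Injective (qTraceLift e r) := by
  let b := Pi.basisFun ℂ (Fin (2 * r + 1))
  let f := e.constr ℂ (Fin.snoc b 0 : Fin (2 * r + 1 + 1) → (Fin (2 * r + 1) → ℂ))
  have hf : f ∘ e = (Fin.snoc b 0 : Fin (2 * r + 1 + 1) → (Fin (2 * r + 1) → ℂ)) :=
    funext fun i => e.constr_basis ℂ _ i
  have hlift : (ExteriorAlgebra.map (exteriorPower.map 2 f)).comp (qTraceLift e r)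
      = qTraceLift b r := by
    refine ExteriorAlgebra.hom_ext ((Pi.basisFun ℂ (Fin r)).ext fun j => ?_)
    simp only [LinearMap.comp_apply, AlgHom.toLinearMap_apply, AlgHom.comp_apply]
    rw [qTraceLift_ι_basisFun, map_qTrace, hf, qTrace_snoc_zero, qTraceLift_ι_basisFun]
  refine Function.Injective.of_comp (f := ExteriorAlgebra.map (exteriorPower.map 2 f)) ?_
  rw [← AlgHom.coe_comp, hlift]
  exact qTraceLift_injective_of_odd b

theorem qTraceLift_injective_of_rank_zero (e : Fin n → V) :
    Function.Injective (qTraceLift e 0) :=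
  injective_of_mem_graded (fun k : ℕ => ⋀[ℂ]^k (⋀[ℂ]^2 V)) (b := Pi.basisFun ℂ (Fin 0))
    (d := 0) (fun j => j.elim0) (fun j => j.elim0) one_ne_zero
    (SetLike.one_mem_graded (A := fun k : ℕ => ⋀[ℂ]^k (⋀[ℂ]^2 V))) (one_mem _)

theorem freelyGenerated_of_qTraceLift_injective {B : LinearMap.BilinForm ℂ V}
    {e : Basis (Fin n) ℂ V} (he : ∀ i j, B (e i) (e j) = if i = j then 1 else 0) {r : ℕ}
    (hr : n ≤ 2 * r + 2) (hinj : Function.Injective (qTraceLift e r)) :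
    FreelyGeneratedAsExteriorAlgebra (orthogonalInvariants B)
      (fun j : Fin r => qTrace e (4 * (j : ℕ) + 3)) where
  generates :=
    (adjoin_qTrace_eq_traceAlgebra e hr).trans (traceAlgebra_eq_orthogonalInvariants he)
  anticommute _ _ := qTrace_mul_qTrace e _ _
  no_other_relations :=
    ⟨qTraceLift e r, fun j => Pi.basisFun_apply ℂ (Fin r) j ▸ qTraceLift_ι_basisFun e j, hinj⟩

end Freeness

end

theorem theorem4p5 {V : Type*} [AddCommGroup V] [Module ℂ V]
    (B : LinearMap.BilinForm ℂ V) (hsymm : B.IsSymm) (hnondeg : B.Nondegenerate)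
    (n : ℕ) (e : Module.Basis (Fin n) ℂ V)
    (he : ∀ i j, B (e i) (e j) = if i = j then 1 else 0) :
    (∀ m : ℕ, n = 2 * m →
      FreelyGeneratedAsExteriorAlgebra (orthogonalInvariants B)
        (fun j : Fin (m - 1) => qTrace e (4 * (j : ℕ) + 3))) ∧
    (∀ m : ℕ, n = 2 * m + 1 →
      FreelyGeneratedAsExteriorAlgebra (orthogonalInvariants B)
        (fun j : Fin m => qTrace e (4 * (j : ℕ) + 3))) := by
  refine ⟨?_, ?_⟩
  · rintro m rfl
    refine freelyGenerated_of_qTraceLift_injective he (by omega) ?_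
    cases m with
    | zero => exact qTraceLift_injective_of_rank_zero e
    | succ r => exact qTraceLift_injective_of_even e
  · rintro m rfl
    exact freelyGenerated_of_qTraceLift_injective he (by omega) (qTraceLift_injective_of_odd e)
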